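/- Let $(\Omega,\mathcal F,\mathbb P)$ be a probability space, $t_0<T$, let $x_0$ be a random variable and $a,b$ stochastic processes with $a,b\in L^2([t_0,T]\times\Omega)$. Let $\mu_a(t)=\mathbb E[a(t)]$, $\mu_b(t)=\mathbb E[b(t)]$, and let $$a(t,\omega)=\mu_a(t)+\sum_{1\le j\le J_a}\sqrt{\nu_j}\,\phi_j(t)\xi_j(\omega),\qquad b(t,\omega)=\mu_b(t)+\sum_{1\le i\le J_b}\sqrt{\gamma_i}\,\psi_i(t)\eta_i(\omega)\qquad (0\le J_a,J_b\le\infty)$$ be Karhunen–Loève expansions: $(\nu_j,\phi_j)$ are pairs of eigenvalues $\nu_j\ge 0$ and orthonormal eigenfunctions in $L^2([t_0,T])$ of the covariance operator $f\mapsto\int_{t_0}^T\mathrm{Cov}[a(\cdot),a(s)]f(s)\,ds$, in any order, which exhaust its nonzero eigenvalues with multiplicity (this operator vanishes on the orthogonal complement of the $\phi_j$); the $\xi_j$ have mean $0$ and variance $1$, are pairwise uncorrelated, and satisfy $\sqrt{\nu_j}\,\xi_j=\int_{t_0}^T(a(s)-\mu_a(s))\phi_j(s)\,ds$ a.s.;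 similarly for $b$. For $N\ge 1$ put $N_a=\min(N,J_a)$, $N_b=\min(N,J_b)$, $\boldsymbol\xi_N=(\xi_1,\dots,\xi_{N_a})$, $\boldsymbol\eta_N=(\eta_1,\dots,\eta_{N_b})$, and for deterministic or random vectors $\boldsymbol\xi_N,\boldsymbol\eta_N$ $$K_a(t,\boldsymbol\xi_N)=\int_{t_0}^t\Big(\mu_a(s)+\sum_{j=1}^{N_a}\sqrt{\nu_j}\,\phi_j(s)\xi_j\Big)ds,\qquad S_b(s,\boldsymbol\eta_N)=\mu_b(s)+\sum_{i=1}^{N_b}\sqrt{\gamma_i}\,\psi_i(s)\eta_i .$$ Let $$x(t,\omega)=x_0(\omega)e^{\int_{t_0}^t a(s,\omega)ds}+\int_{t_0}^t b(s,\omega)e^{\int_s^t a(r,\omega)dr}ds$$ be the solution of $x'=ax+b$, $x(t_0)=x_0$, and let $x_N(t,\omega)$ be given by the same formula with $a,b$ replaced by their truncations $a_N(s,\omega)=\mu_a(s)+\sum_{j=1}^{N_a}\sqrt{\nu_j}\phi_j(s)\xi_j(\omega)$ and $b_N(s,\omega)=S_b(s,\boldsymbol\eta_N(\omega))$. **Theorem.**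 Assume: 1. for every $N\ge1$, $x_0$ and $(\boldsymbol\xi_N,\boldsymbol\eta_N)$ are absolutely continuous, with densities $f_0$ and $f_{\boldsymbol\xi_N,\boldsymbol\eta_N}$, and are independent; 2. $f_0$ is Lipschitz on $\mathbb R$; 3. there exist $2\le p\le\infty$ and $4\le q\le\infty$ with $1/p+2/q=1/2$ such that $$\|\mu_b\|_{L^p(t_0,T)}+\sum_{1\le j\le J_b}\sqrt{\gamma_j}\,\|\psi_j\|_{L^p(t_0,T)}\|\eta_j\|_{L^p(\Omega)}<\infty,$$ and there is a constant $C$ with $\|e^{-K_a(t,\boldsymbol\xi_N)}\|_{L^q(\Omega)}\le C$ for all $N\ge1$ and $t\in[t_0,T]$. For $N\ge 1$ put $$f_1^N(x,t)=\int_{\mathbb R^{N_a+N_b}} f_0\Big(x\,e^{-K_a(t,\boldsymbol\xi_N)}-\int_{t_0}^t S_b(s,\boldsymbol\eta_N)e^{-K_a(s,\boldsymbol\xi_N)}ds\Big) f_{\boldsymbol\xi_N,\boldsymbol\eta_N}(\boldsymbol\xi_N,\boldsymbol\eta_N)\,e^{-K_a(t,\boldsymbol\xi_N)}\,d\boldsymbol\xi_N\,d\boldsymbol\eta_N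 .$$ Then, for every $N\ge1$ and $t\in[t_0,T]$, $f_1^N(\cdot,t)$ is a density of $x_N(t,\cdot)$. Moreover, there is a function $f_1(x,t)$ such that $f_1(\cdot,t)$ is a density of $x(t,\cdot)$ for every $t\in[t_0,T]$, $f_1^N(x,t)\to f_1(x,t)$ for all $x\in\mathbb R$ and $t\in[t_0,T]$, and, for every bounded $J\subseteq\mathbb R$, the functions $f_1^N$ ($N\ge 1$) and $f_1$ belong to $L^\infty(J\times[t_0,T])$ and $f_1^N\to f_1$ in $L^\infty(J\times[t_0,T])$ as $N\to\infty$. -/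

import Mathlib

open MeasureTheory ProbabilityTheory Set Filter Topology
open scoped ENNReal NNReal

noncomputable section

namespace RandomLinearODE

/-- `f` is a probability density function of the random vector `Y` with respect to Lebesgue measure
(so `Y` is absolutely continuous). -/
structure HasDensity {Ω E : Type*} [MeasurableSpace Ω] [MeasureSpace E]
    (P : Measure Ω) (Y : Ω → E) (f : E → ℝ) : Prop where
  aemeasurable : AEMeasurable Y P
  measurable : Measurable f
  nonneg : ∀ y, 0 ≤ f y
  map_eq : P.map Y = (volume : Measure E).withDensity (fun y => ENNReal.ofReal (f y))

/-- Lebesgue measure on the time interval `[t0, T]`. -/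
abbrev timeMeasure (t0 T : ℝ) : Measure ℝ := volume.restrict (Icc t0 T)

/-- The mean function `t ↦ E[X(t)]` of a process. -/
def meanFun {Ω : Type*} [MeasurableSpace Ω] (P : Measure Ω) (X : ℝ → Ω → ℝ) (t : ℝ) : ℝ :=
  ∫ ω, X t ω ∂P

/-- The covariance integral operator `(C f)(t) = ∫ Cov[X(t), X(s)] f(s) ds` over `[t0, T]`. -/
def covOp {Ω : Type*} [MeasurableSpace Ω] (P : Measure Ω) (t0 T : ℝ) (X : ℝ → Ω → ℝ)
    (f : ℝ → ℝ) (t : ℝ) : ℝ :=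
  ∫ s, covariance (X t) (X s) P * f s ∂(timeMeasure t0 T)

/-- `(ν j, φ j, ξ j)`, for the indices `j < J` (where `J` may be infinite), are the eigenvalues,
eigenfunctions and random coefficients of a Karhunen-Loève expansion
`X(t) = E[X(t)] + ∑ j < J, √(ν j) φ j (t) ξ j` on `[t0, T]`, in some order.
All nonzero eigenvalues are listed (with multiplicity), since `C` vanishes on the orthogonal
complement of the listed eigenfunctions; eigenvalues equal to zero may be listed or not.
Entries with index `j ≥ J` are irrelevant. The convergence of the expansion is not a part of this
definition. -/
structure IsKarhunenLoeve {Ω : Type*} [MeasurableSpace Ω] (P : Measure Ω) (t0 T : ℝ)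
    (X : ℝ → Ω → ℝ) (J : ℕ∞) (ν : ℕ → ℝ) (φ : ℕ → ℝ → ℝ) (ξ : ℕ → Ω → ℝ) : Prop where
  eigenvalue_nonneg : ∀ j : ℕ, (j : ℕ∞) < J → 0 ≤ ν j
  memLp_eigenfunction : ∀ j : ℕ, (j : ℕ∞) < J → MemLp (φ j) 2 (timeMeasure t0 T)
  orthonormal : ∀ i j : ℕ, (i : ℕ∞) < J → (j : ℕ∞) < J →
    ∫ s, φ i s * φ j s ∂(timeMeasure t0 T) = if i = j then 1 else 0
  eigen : ∀ j : ℕ, (j : ℕ∞) < J →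
    ∀ᵐ t ∂(timeMeasure t0 T), covOp P t0 T X (φ j) t = ν j * φ j t
  complete : ∀ f : ℝ → ℝ, MemLp f 2 (timeMeasure t0 T) →
    (∀ j : ℕ, (j : ℕ∞) < J → ∫ s, f s * φ j s ∂(timeMeasure t0 T) = 0) →
    ∀ᵐ t ∂(timeMeasure t0 T), covOp P t0 T X f t = 0
  coeff : ∀ j : ℕ, (j : ℕ∞) < J → ∀ᵐ ω ∂P,
    √(ν j) * ξ j ω = ∫ s, (X s ω - meanFun P X s) * φ j s ∂(timeMeasure t0 T)
  memLp_coeff : ∀ j : ℕ, (j : ℕ∞) < J → MemLp (ξ j) 2 P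
  mean_coeff : ∀ j : ℕ, (j : ℕ∞) < J → ∫ ω, ξ j ω ∂P = 0
  cov_coeff : ∀ i j : ℕ, (i : ℕ∞) < J → (j : ℕ∞) < J →
    covariance (ξ i) (ξ j) P = if i = j then 1 else 0

/-- The number of terms in the truncation of order `N` of an expansion with `J` terms:
`N`, stopping at `J` if `J < N`. -/
def numTerms (J : ℕ∞) (N : ℕ) : ℕ := (min (N : ℕ∞) J).toNat

/-- The first `n` coefficients, as a random vector. -/
def headVec {Ω : Type*} (ξ : ℕ → Ω → ℝ) (n : ℕ) (ω : Ω) : Fin n → ℝ := fun j => ξ j ω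

/-- The truncated expansion `m(s) + ∑ j < n, √(ν j) φ j (s) z j`, for a vector `z` of `n`
deterministic values of the coefficients. -/
def klSum (m : ℝ → ℝ) (ν : ℕ → ℝ) (φ : ℕ → ℝ → ℝ) {n : ℕ} (z : Fin n → ℝ) (s : ℝ) : ℝ :=
  m s + ∑ j : Fin n, √(ν j) * φ j s * z j

/-- `K(t, z) = ∫ s in t0..t, (m(s) + ∑ j < n, √(ν j) φ j (s) z j)`. -/
def klIntegral (t0 : ℝ) (m : ℝ → ℝ) (ν : ℕ → ℝ) (φ : ℕ → ℝ → ℝ) (t : ℝ) {n : ℕ}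
    (z : Fin n → ℝ) : ℝ :=
  ∫ s in t0..t, klSum m ν φ z s

/-- The truncation of order `N` of the Karhunen-Loève expansion of the process `X`. -/
def klTrunc {Ω : Type*} [MeasurableSpace Ω] (P : Measure Ω) (X : ℝ → Ω → ℝ) (J : ℕ∞)
    (ν : ℕ → ℝ) (φ : ℕ → ℝ → ℝ) (ξ : ℕ → Ω → ℝ) (N : ℕ) (s : ℝ) (ω : Ω) : ℝ :=
  klSum (meanFun P X) ν φ (headVec ξ (numTerms J N) ω) s

/-- The solution process
`x(t) = x0 exp(∫ a over [t0, t]) + ∫ s in [t0, t], b(s) exp(∫ a over [s, t])`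
of `x' = a x + b`, `x(t0) = x0`. -/
def solution {Ω : Type*} (t0 : ℝ) (a b : ℝ → Ω → ℝ) (x0 : Ω → ℝ) (t : ℝ) (ω : Ω) : ℝ :=
  x0 ω * Real.exp (∫ s in t0..t, a s ω)
    + ∫ s in t0..t, b s ω * Real.exp (∫ r in s..t, a r ω)

/-- The integral
`∫ f0(x e^{-K(t,z)} - ∫ s in t0..t, S(s,w) e^{-K(s,z)}) fj(z,w) e^{-K(t,z)} dz dw`, where `K` is
built from the mean `ma` and the eigenpairs `(ν, φ)`, and `S` from the mean `mb` and the eigenpairs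
`(γ, ψ)`; here `fj` is a joint density of the first `n` and `m` coefficients. -/
def truncDensity (t0 : ℝ) (ma mb : ℝ → ℝ) (ν γ : ℕ → ℝ) (φ ψ : ℕ → ℝ → ℝ) (f0 : ℝ → ℝ)
    {n m : ℕ} (fj : (Fin n → ℝ) × (Fin m → ℝ) → ℝ) (x t : ℝ) : ℝ :=
  ∫ z : (Fin n → ℝ) × (Fin m → ℝ),
    f0 (x * Real.exp (-klIntegral t0 ma ν φ t z.1)
        - ∫ s in t0..t, klSum mb γ ψ z.2 s * Real.exp (-klIntegral t0 ma ν φ s z.1))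
      * fj z * Real.exp (-klIntegral t0 ma ν φ t z.1)

end RandomLinearODE

end

open RandomLinearODE

/-!
Write `K(t) = ∫ a` and `B(t) = ∫ b(s) e^{-K(s)} ds`, both over `[t0, t]`, so that the solution is
`x(t) = e^{K(t)} (x0 + B(t))` (`solution_eq_exp_mul_add`). If `x0` has density `f0` and is
independent of `(K(t), B(t))`, conditioning on the latter and changing variables shows that `x(t)`
has density `F(x, t) = E[f0(x e^{-K(t)} - B(t)) e^{-K(t)}]` (`hasDensity_exp_mul_add`), called
`mixDensity` below. For the truncated problems `K` and `B` are functions of the finitely many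
coefficients, and the law of those coefficients turns `F` into `truncDensity`
(`truncDensity_eq_mixDensity`).

The limit is the same expectation `F` for the original processes. Its convergence rests on two
facts.

* The truncations converge in `L²([t0, T] × Ω)` (`IsKarhunenLoeve.tendsto_eLpNorm`). If `f` is
  orthogonal to all eigenfunctions, then the covariance operator annihilates `f`, so `⟨X - E X, f⟩`
  has second moment zero. Hence almost every centered path lies in the closed span of the
  eigenfunctions, where its orthogonal expansion converges; dominated convergence does the rest.
* `F` is a locally Lipschitz function of the coefficients in `L²` (`enorm_mixDensity_sub_le`),
  uniformly in `t` and in `x` from a bounded set. Since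
  `|e^{-u} - e^{-v}| ≤ |u - v| (e^{-u} + e^{-v})`, this is Hölder's inequality with exponents
  `p, 2, q, q`, for which `1/p + 1/2 + 2/q = 1` is exactly what is assumed. The bound in `L^q` for
  `e^{-K}` comes from the truncations by Fatou's lemma.

That the limit of the densities is a density of the limit follows without discussing the
independence of `x0` and `(K(t), B(t))`: along a subsequence the truncated solutions converge
almost surely, so both candidate laws integrate every compactly supported continuous function to
the same value (`IsApproximation.hasDensity_solution`).
-/

namespace RandomLinearODE

section

/-- The pathwise primitive `∫ a over [t0, t]` of a process `a`. -/
noncomputable def primitive {Ω : Type*} (t0 : ℝ) (a : ℝ → Ω → ℝ) (t : ℝ) (ω : Ω) : ℝ :=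
  ∫ s in t0..t, a s ω

/-- The discounted inhomogeneity `B(t) = ∫ s in t0..t, b(s) exp(-∫ a over [t0, s])`, so that
the solution is `exp(∫ a over [t0, t]) * (x0 + B(t))`. -/
noncomputable def discounted {Ω : Type*} (t0 : ℝ) (a b : ℝ → Ω → ℝ) : ℝ → Ω → ℝ :=
  primitive t0 fun s ω => b s ω * Real.exp (-primitive t0 a s ω)

/-- The mixture `E[f0(x e^{-K(t)} - B(t)) e^{-K(t)}]`, where `K` is the primitive of `a` and `B`
is the discounted inhomogeneity. It is the density of the solution when `x0` has density `f0` and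
is independent of `(K(t), B(t))`. -/
noncomputable def mixDensity {Ω : Type*} [MeasurableSpace Ω] (P : Measure Ω) (t0 : ℝ)
    (a b : ℝ → Ω → ℝ) (f0 : ℝ → ℝ) (x t : ℝ) : ℝ :=
  ∫ ω, f0 (x * Real.exp (-primitive t0 a t ω) - discounted t0 a b t ω)
    * Real.exp (-primitive t0 a t ω) ∂P

/-! ### Measurability of the pathwise integrals -/

variable {Ω : Type*} [MeasurableSpace Ω] {P : Measure Ω} {t0 T : ℝ}

lemma intervalIntegral_eq_integral_indicator (g : ℝ → ℝ) {t : ℝ} (ht : t ∈ Icc t0 T) :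
    ∫ s in t0..t, g s = ∫ s, (Iic t).indicator g s ∂(timeMeasure t0 T) := by
  rw [intervalIntegral.integral_of_le ht.1, integral_indicator measurableSet_Iic,
    ← integral_Icc_eq_integral_Ioc, Measure.restrict_restrict measurableSet_Iic]
  congr 2
  ext s
  simp only [mem_Icc, mem_inter_iff, mem_Iic]
  constructor
  · rintro ⟨h1, h2⟩
    exact ⟨h2, h1, h2.trans ht.2⟩
  · rintro ⟨h1, h2, -⟩
    exact ⟨h2, h1⟩

lemma ae_timeMeasure_of_forall {p : ℝ → Prop} (h : ∀ t ∈ Icc t0 T, p t) :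
    ∀ᵐ t ∂(timeMeasure t0 T), p t :=
  (ae_restrict_mem measurableSet_Icc).mono h

lemma ae_prod_timeMeasure_of_forall [SFinite P] {p : ℝ × Ω → Prop}
    (h : ∀ t ∈ Icc t0 T, ∀ ω, p (t, ω)) : ∀ᵐ z ∂((timeMeasure t0 T).prod P), p z := by
  have := Measure.quasiMeasurePreserving_fst (μ := timeMeasure t0 T) (ν := P)
  exact (this.ae (ae_restrict_mem measurableSet_Icc)).mono fun z hz => h z.1 hz z.2

lemma aestronglyMeasurable_primitive [SFinite P] {a : ℝ → Ω → ℝ}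
    (ha : AEStronglyMeasurable (fun z : ℝ × Ω => a z.1 z.2) ((timeMeasure t0 T).prod P)) :
    AEStronglyMeasurable (fun z : ℝ × Ω => primitive t0 a z.1 z.2)
      ((timeMeasure t0 T).prod P) := by
  have hq : Measure.QuasiMeasurePreserving (fun z : (ℝ × Ω) × ℝ => (z.1.2, z.2))
      (((timeMeasure t0 T).prod P).prod (timeMeasure t0 T)) (P.prod (timeMeasure t0 T)) :=
    QuasiMeasurePreserving.prodMap Measure.quasiMeasurePreserving_snd
      (Measure.QuasiMeasurePreserving.id _)
  have h1 := ha.prod_swap.comp_quasiMeasurePreserving hq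
  have hS : MeasurableSet {z : (ℝ × Ω) × ℝ | z.2 ≤ z.1.1} :=
    measurableSet_le measurable_snd measurable_fst.fst
  have h2 := (h1.indicator hS).integral_prod_right'
  refine h2.congr (ae_prod_timeMeasure_of_forall fun t ht ω => ?_)
  exact (intervalIntegral_eq_integral_indicator (fun s => a s ω) ht).symm

lemma aestronglyMeasurable_primitive_apply [SFinite P] {a : ℝ → Ω → ℝ}
    (ha : AEStronglyMeasurable (fun z : ℝ × Ω => a z.1 z.2) ((timeMeasure t0 T).prod P))
    {t : ℝ} (ht : t ∈ Icc t0 T) :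
    AEStronglyMeasurable (primitive t0 a t) P := by
  have hS : MeasurableSet {z : Ω × ℝ | z.2 ≤ t} :=
    measurableSet_le measurable_snd measurable_const
  have h2 := (ha.prod_swap.indicator hS).integral_prod_right'
  refine h2.congr (Eventually.of_forall fun ω => ?_)
  exact (intervalIntegral_eq_integral_indicator (fun s => a s ω) ht).symm

section

variable {a b : ℝ → Ω → ℝ}

lemma aestronglyMeasurable_mul_exp_neg_primitive [SFinite P]
    (ha : AEStronglyMeasurable (fun z : ℝ × Ω => a z.1 z.2) ((timeMeasure t0 T).prod P))
    (hb : AEStronglyMeasurable (fun z : ℝ × Ω => b z.1 z.2) ((timeMeasure t0 T).prod P)) :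
    AEStronglyMeasurable (fun z : ℝ × Ω => b z.1 z.2 * Real.exp (-primitive t0 a z.1 z.2))
      ((timeMeasure t0 T).prod P) :=
  hb.mul (Real.continuous_exp.comp_aestronglyMeasurable (aestronglyMeasurable_primitive ha).neg)

lemma aestronglyMeasurable_discounted [SFinite P]
    (ha : AEStronglyMeasurable (fun z : ℝ × Ω => a z.1 z.2) ((timeMeasure t0 T).prod P))
    (hb : AEStronglyMeasurable (fun z : ℝ × Ω => b z.1 z.2) ((timeMeasure t0 T).prod P)) :
    AEStronglyMeasurable (fun z : ℝ × Ω => discounted t0 a b z.1 z.2)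
      ((timeMeasure t0 T).prod P) :=
  aestronglyMeasurable_primitive (aestronglyMeasurable_mul_exp_neg_primitive ha hb)

lemma aestronglyMeasurable_discounted_apply [SFinite P]
    (ha : AEStronglyMeasurable (fun z : ℝ × Ω => a z.1 z.2) ((timeMeasure t0 T).prod P))
    (hb : AEStronglyMeasurable (fun z : ℝ × Ω => b z.1 z.2) ((timeMeasure t0 T).prod P))
    {t : ℝ} (ht : t ∈ Icc t0 T) : AEStronglyMeasurable (discounted t0 a b t) P :=
  aestronglyMeasurable_primitive_apply (aestronglyMeasurable_mul_exp_neg_primitive ha hb) ht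

lemma aestronglyMeasurable_mixDensity_integrand [SFinite P]
    (ha : AEStronglyMeasurable (fun z : ℝ × Ω => a z.1 z.2) ((timeMeasure t0 T).prod P))
    (hb : AEStronglyMeasurable (fun z : ℝ × Ω => b z.1 z.2) ((timeMeasure t0 T).prod P))
    {f0 : ℝ → ℝ} (hf0 : Continuous f0) (x : ℝ) {t : ℝ} (ht : t ∈ Icc t0 T) :
    AEStronglyMeasurable (fun ω => f0 (x * Real.exp (-primitive t0 a t ω) - discounted t0 a b t ω)
      * Real.exp (-primitive t0 a t ω)) P := by
  have hE : AEStronglyMeasurable (fun ω => Real.exp (-primitive t0 a t ω)) P :=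
    Real.continuous_exp.comp_aestronglyMeasurable (aestronglyMeasurable_primitive_apply ha ht).neg
  exact (hf0.comp_aestronglyMeasurable ((hE.const_mul x).sub
    (aestronglyMeasurable_discounted_apply ha hb ht))).mul hE

lemma aestronglyMeasurable_mixDensity [SFinite P]
    (ha : AEStronglyMeasurable (fun z : ℝ × Ω => a z.1 z.2) ((timeMeasure t0 T).prod P))
    (hb : AEStronglyMeasurable (fun z : ℝ × Ω => b z.1 z.2) ((timeMeasure t0 T).prod P))
    {f0 : ℝ → ℝ} (hf0 : Continuous f0) :
    AEStronglyMeasurable (fun z : ℝ × ℝ => mixDensity P t0 a b f0 z.1 z.2)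
      (volume.restrict (univ ×ˢ Icc t0 T)) := by
  have hv : (volume : Measure (ℝ × ℝ)).restrict (univ ×ˢ Icc t0 T)
      = (volume : Measure ℝ).prod (timeMeasure t0 T) := by
    rw [Measure.volume_eq_prod, ← Measure.prod_restrict, Measure.restrict_univ]
  rw [hv]
  have hq : Measure.QuasiMeasurePreserving (fun z : (ℝ × ℝ) × Ω => (z.1.2, z.2))
      (((volume : Measure ℝ).prod (timeMeasure t0 T)).prod P) ((timeMeasure t0 T).prod P) :=
    QuasiMeasurePreserving.prodMap Measure.quasiMeasurePreserving_snd
      (Measure.QuasiMeasurePreserving.id _)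
  have hE := Real.continuous_exp.comp_aestronglyMeasurable
    ((aestronglyMeasurable_primitive ha).comp_quasiMeasurePreserving hq).neg
  have hB := (aestronglyMeasurable_discounted ha hb).comp_quasiMeasurePreserving hq
  have hx : AEStronglyMeasurable (fun z : (ℝ × ℝ) × Ω => z.1.1)
      (((volume : Measure ℝ).prod (timeMeasure t0 T)).prod P) :=
    measurable_fst.fst.aestronglyMeasurable
  exact ((hf0.comp_aestronglyMeasurable ((hx.mul hE).sub hB)).mul hE).integral_prod_right'

end

/-! ### Lipschitz probability densities -/

/-- A Lipschitz probability density on the line is bounded: near a point where it is large it is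
large on an interval of fixed length. -/
lemma bddAbove_of_lipschitz_of_integrable {f : ℝ → ℝ} {L : ℝ≥0} (hL : LipschitzWith L f)
    (hf : ∀ x, 0 ≤ f x) (hint : Integrable f) : ∃ M, ∀ x, f x ≤ M := by
  refine ⟨L + ∫ y, f y, fun x => ?_⟩
  have h1 : ∫ y in Icc x (x + 1), (f x - L) ≤ ∫ y in Icc x (x + 1), f y := by
    refine setIntegral_mono_on (by simp) hint.integrableOn measurableSet_Icc fun y hy => ?_
    have := hL.dist_le_mul x y
    rw [Real.dist_eq, Real.dist_eq] at this
    have h3 : |x - y| ≤ 1 := by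
      rw [abs_le]
      constructor <;> linarith [hy.1, hy.2]
    have h4 : (L : ℝ) * |x - y| ≤ L * 1 := mul_le_mul_of_nonneg_left h3 L.2
    linarith [le_abs_self (f x - f y)]
  have h2 : ∫ y in Icc x (x + 1), f y ≤ ∫ y, f y :=
    setIntegral_le_integral hint (Eventually.of_forall hf)
  simp only [integral_const, MeasurableSet.univ, measureReal_restrict_apply, univ_inter,
    Real.volume_real_Icc, add_sub_cancel_left, smul_eq_mul] at h1
  norm_num at h1
  linarith

lemma HasDensity.integrable {Ω E : Type*} [MeasurableSpace Ω] [MeasureSpace E] {P : Measure Ω}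
    [IsFiniteMeasure P] {Y : Ω → E} {f : E → ℝ} (h : HasDensity P Y f) : Integrable f := by
  refine ⟨h.measurable.aestronglyMeasurable, ?_⟩
  rw [hasFiniteIntegral_iff_ofReal (Eventually.of_forall h.nonneg)]
  have : (volume : Measure E).withDensity (fun y => ENNReal.ofReal (f y)) univ < ∞ := by
    rw [← h.map_eq]
    exact measure_lt_top _ _
  rwa [withDensity_apply _ MeasurableSet.univ, Measure.restrict_univ] at this

end

section

section

/-! ### The solution in terms of the primitive and the discounted inhomogeneity -/

variable {Ω : Type*} {t0 T : ℝ} {a b : ℝ → Ω → ℝ}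

lemma intervalIntegrable_of_integrable {g : ℝ → ℝ} (hg : Integrable g (timeMeasure t0 T))
    {s t : ℝ} (hs : s ∈ Icc t0 T) (ht : t ∈ Icc t0 T) : IntervalIntegrable g volume s t :=
  IntegrableOn.intervalIntegrable (IntegrableOn.mono_set (s := uIcc s t) hg
    (by rw [uIcc]; exact Icc_subset_Icc (le_min hs.1 ht.1) (max_le hs.2 ht.2)))

lemma continuousOn_primitive {ω : Ω} (hT : t0 ≤ T)
    (ha : Integrable (fun s => a s ω) (timeMeasure t0 T)) :
    ContinuousOn (fun t => primitive t0 a t ω) (Icc t0 T) := by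
  have := intervalIntegral.continuousOn_primitive_interval (μ := volume) (f := fun s => a s ω)
    (a := t0) (b := T) (by rw [uIcc_of_le hT]; exact ha)
  rwa [uIcc_of_le hT] at this

lemma integrable_mul_exp_neg_primitive {ω : Ω} (hT : t0 ≤ T)
    (ha : Integrable (fun s => a s ω) (timeMeasure t0 T))
    (hb : Integrable (fun s => b s ω) (timeMeasure t0 T)) :
    Integrable (fun s => b s ω * Real.exp (-primitive t0 a s ω)) (timeMeasure t0 T) :=
  IntegrableOn.mul_continuousOn (g := fun s => b s ω) hb
    ((continuousOn_primitive hT ha).neg.rexp) isCompact_Icc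

lemma solution_eq_exp_mul_add (x0 : Ω → ℝ) {ω : Ω}
    (ha : Integrable (fun s => a s ω) (timeMeasure t0 T)) {t : ℝ} (ht : t ∈ Icc t0 T) :
    solution t0 a b x0 t ω
      = Real.exp (primitive t0 a t ω) * (x0 ω + discounted t0 a b t ω) := by
  have h1 : ∫ s in t0..t, b s ω * Real.exp (∫ r in s..t, a r ω)
      = ∫ s in t0..t, Real.exp (primitive t0 a t ω)
        * (b s ω * Real.exp (-primitive t0 a s ω)) := by
    refine intervalIntegral.integral_congr fun s hs => ?_
    rw [uIcc_of_le ht.1] at hs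
    have hs' : s ∈ Icc t0 T := ⟨hs.1, hs.2.trans ht.2⟩
    have h0 : t0 ∈ Icc t0 T := ⟨le_rfl, ht.1.trans ht.2⟩
    have h2 := intervalIntegral.integral_interval_sub_left
      (intervalIntegrable_of_integrable ha h0 ht) (intervalIntegrable_of_integrable ha h0 hs')
    change b s ω * Real.exp (∫ r in s..t, a r ω)
      = Real.exp (primitive t0 a t ω) * (b s ω * Real.exp (-primitive t0 a s ω))
    rw [← h2, sub_eq_add_neg, Real.exp_add, primitive, primitive]
    ring
  rw [solution, h1, intervalIntegral.integral_const_mul, discounted, primitive, primitive]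
  ring

end

/-! ### Random affine images of a random variable with a density -/

lemma withDensity_affine_preimage {f : ℝ → ℝ} (hf : Measurable f) (k β : ℝ) {A : Set ℝ}
    (hA : MeasurableSet A) :
    (volume : Measure ℝ).withDensity (fun y => ENNReal.ofReal (f y))
        ((fun u => Real.exp k * (u + β)) ⁻¹' A)
      = ∫⁻ x in A, ENNReal.ofReal (f (x * Real.exp (-k) - β) * Real.exp (-k)) := by
  have hm : Measurable fun u : ℝ => Real.exp k * (u + β) := by fun_prop
  have hg : Measurable fun x => ENNReal.ofReal (f (x * Real.exp (-k) - β) * Real.exp (-k)) := by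
    fun_prop
  have hsub : ∀ h : ℝ → ℝ≥0∞, Measurable h →
      ∫⁻ x, h x = ENNReal.ofReal (Real.exp k) * ∫⁻ u, h (Real.exp k * (u + β)) := by
    intro h hh
    rw [lintegral_add_right_eq_self (fun u => h (Real.exp k * u)) β]
    have h1 := Real.smul_map_volume_mul_left (Real.exp_pos k).ne'
    rw [abs_of_pos (Real.exp_pos k)] at h1
    conv_lhs => rw [← h1]
    rw [lintegral_smul_measure, lintegral_map hh (by fun_prop), smul_eq_mul]
  rw [withDensity_apply _ (hm hA), ← lintegral_indicator (hm hA), ← lintegral_indicator hA,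
    hsub _ (hg.indicator hA),
    ← lintegral_const_mul (f := fun u => A.indicator _ (Real.exp k * (u + β))) _
      ((hg.indicator hA).comp hm)]
  congr 1 with u
  by_cases hu : Real.exp k * (u + β) ∈ A
  · have hu' : u ∈ (fun u => Real.exp k * (u + β)) ⁻¹' A := hu
    rw [indicator_of_mem hu, indicator_of_mem hu', ← ENNReal.ofReal_mul (Real.exp_pos k).le]
    have h1 : Real.exp k * Real.exp (-k) = 1 := by rw [← Real.exp_add]; simp
    have h2 : Real.exp k * (u + β) * Real.exp (-k) - β = u := by
      linear_combination (u + β) * h1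
    rw [h2]
    congr 1
    linear_combination (-f u) * h1
  · have hu' : u ∉ (fun u => Real.exp k * (u + β)) ⁻¹' A := hu
    rw [indicator_of_notMem hu, indicator_of_notMem hu', mul_zero]

variable {Ω : Type*} [MeasurableSpace Ω] {P : Measure Ω}

lemma integrable_mix {f : ℝ → ℝ} (hc : Continuous f) (hf : ∀ x, 0 ≤ f x) {M : ℝ}
    (hM : ∀ x, f x ≤ M) {K B : Ω → ℝ} (hB : AEStronglyMeasurable B P)
    (hE : Integrable (fun ω => Real.exp (-K ω)) P) (x : ℝ) :
    Integrable (fun ω => f (x * Real.exp (-K ω) - B ω) * Real.exp (-K ω)) P := by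
  refine hE.bdd_mul (c := M) (hc.comp_aestronglyMeasurable
    ((hE.aestronglyMeasurable.const_mul x).sub hB)) (Eventually.of_forall fun ω => ?_)
  rw [Real.norm_of_nonneg (hf _)]
  exact hM _

lemma continuous_mix {f : ℝ → ℝ} (hc : Continuous f) (hf : ∀ x, 0 ≤ f x) {M : ℝ}
    (hM : ∀ x, f x ≤ M) {K B : Ω → ℝ} (hB : AEStronglyMeasurable B P)
    (hE : Integrable (fun ω => Real.exp (-K ω)) P) :
    Continuous fun x => ∫ ω, f (x * Real.exp (-K ω) - B ω) * Real.exp (-K ω) ∂P := by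
  refine continuous_of_dominated (bound := fun ω => M * Real.exp (-K ω))
    (fun x => (integrable_mix hc hf hM hB hE x).aestronglyMeasurable) (fun x => ?_)
    (hE.const_mul M) (Eventually.of_forall fun ω => by fun_prop)
  refine Eventually.of_forall fun ω => ?_
  rw [norm_mul, Real.norm_of_nonneg (hf _), Real.norm_of_nonneg (Real.exp_pos _).le]
  exact mul_le_mul_of_nonneg_right (hM _) (Real.exp_pos _).le

/-- If `x0` has density `f` and is independent of `(K, B)`, then `exp K * (x0 + B)` has density
`x ↦ E[f (x e^{-K} - B) e^{-K}]`: condition on `(K, B)` and change variables. -/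
lemma hasDensity_exp_mul_add [IsProbabilityMeasure P] {x0 : Ω → ℝ} {f : ℝ → ℝ}
    (h0 : HasDensity P x0 f) (hc : Continuous f) {M : ℝ} (hM : ∀ x, f x ≤ M) {K B : Ω → ℝ}
    (hK : AEStronglyMeasurable K P) (hB : AEStronglyMeasurable B P)
    (hE : Integrable (fun ω => Real.exp (-K ω)) P)
    (hind : IndepFun x0 (fun ω => (K ω, B ω)) P) :
    HasDensity P (fun ω => Real.exp (K ω) * (x0 ω + B ω))
      (fun x => ∫ ω, f (x * Real.exp (-K ω) - B ω) * Real.exp (-K ω) ∂P) where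
  aemeasurable := hK.aemeasurable.exp.mul (h0.aemeasurable.add hB.aemeasurable)
  measurable := (continuous_mix hc h0.nonneg hM hB hE).measurable
  nonneg x := integral_nonneg fun ω => mul_nonneg (h0.nonneg _) (Real.exp_pos _).le
  map_eq := by
    have hKB : AEMeasurable (fun ω => (K ω, B ω)) P := hK.aemeasurable.prodMk hB.aemeasurable
    have hprod := hind.map_prod_eq_prod_map_map h0.aemeasurable hKB
    have hG : Measurable fun p : ℝ × (ℝ × ℝ) => Real.exp p.2.1 * (p.1 + p.2.2) := by fun_prop
    have hπ : IsProbabilityMeasure (P.map fun ω => (K ω, B ω)) :=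
      Measure.isProbabilityMeasure_map hKB
    have hx0 : IsProbabilityMeasure (P.map x0) := Measure.isProbabilityMeasure_map h0.aemeasurable
    have hH : Measurable fun p : ℝ × (ℝ × ℝ) =>
        ENNReal.ofReal (f (p.1 * Real.exp (-p.2.1) - p.2.2) * Real.exp (-p.2.1)) := by
      fun_prop
    ext A hA
    have h1 : P.map (fun ω => Real.exp (K ω) * (x0 ω + B ω)) A
        = ((P.map x0).prod (P.map fun ω => (K ω, B ω)))
          ((fun p : ℝ × (ℝ × ℝ) => Real.exp p.2.1 * (p.1 + p.2.2)) ⁻¹' A) := by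
      rw [← hprod, Measure.map_apply_of_aemeasurable (h0.aemeasurable.prodMk hKB) (hG hA),
        Measure.map_apply_of_aemeasurable
          (f := fun ω => Real.exp (K ω) * (x0 ω + B ω))
          (hK.aemeasurable.exp.mul (h0.aemeasurable.add hB.aemeasurable)) hA]
      rfl
    rw [h1, Measure.prod_apply_symm (hG hA), withDensity_apply _ hA]
    have h2 : ∀ z : ℝ × ℝ, (P.map x0) ((fun u => (u, z)) ⁻¹'
        ((fun p : ℝ × (ℝ × ℝ) => Real.exp p.2.1 * (p.1 + p.2.2)) ⁻¹' A))
        = ∫⁻ x in A, ENNReal.ofReal (f (x * Real.exp (-z.1) - z.2) * Real.exp (-z.1)) := by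
      intro z
      rw [h0.map_eq]
      exact withDensity_affine_preimage h0.measurable z.1 z.2 hA
    simp_rw [h2]
    rw [lintegral_lintegral_swap
      (f := fun (z : ℝ × ℝ) x => ENNReal.ofReal (f (x * Real.exp (-z.1) - z.2) * Real.exp (-z.1)))
      (hH.comp measurable_swap).aemeasurable]
    refine lintegral_congr fun x => ?_
    rw [lintegral_map' (by fun_prop) hKB, ofReal_integral_eq_lintegral_ofReal
      (integrable_mix hc h0.nonneg hM hB hE x)
      (Eventually.of_forall fun ω => mul_nonneg (h0.nonneg _) (Real.exp_pos _).le)]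

end

section

/-- A jointly measurable process almost all of whose paths are integrable over `[t0, T]`. -/
structure IsPathIntegrable {Ω : Type*} [MeasurableSpace Ω] (P : Measure Ω) (t0 T : ℝ)
    (a : ℝ → Ω → ℝ) : Prop where
  aesm : AEStronglyMeasurable (fun z : ℝ × Ω => a z.1 z.2) ((timeMeasure t0 T).prod P)
  integrable : ∀ᵐ ω ∂P, Integrable (fun s => a s ω) (timeMeasure t0 T)

/-- The distance of two processes in `L²([t0, T] × Ω)`, scaled by the square root of the length of
the time interval; it dominates the distance in `L¹([t0, T]; L²(Ω))`. -/
noncomputable def scaledDist {Ω : Type*} [MeasurableSpace Ω] (P : Measure Ω) (t0 T : ℝ)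
    (a a' : ℝ → Ω → ℝ) : ℝ≥0∞ :=
  (timeMeasure t0 T univ) ^ (1 / 2 : ℝ)
    * eLpNorm (fun z : ℝ × Ω => a' z.1 z.2 - a z.1 z.2) 2 ((timeMeasure t0 T).prod P)

/-! ### Hölder estimates -/

section

variable {α : Type*} [MeasurableSpace α] {μ : Measure α}

/-- The Cauchy–Schwarz inequality for lower Lebesgue integrals. -/
lemma sq_lintegral_mul_le {f g : α → ℝ≥0∞} (hf : AEMeasurable f μ) (hg : AEMeasurable g μ) :
    (∫⁻ x, f x * g x ∂μ) ^ 2 ≤ (∫⁻ x, f x ^ 2 ∂μ) * ∫⁻ x, g x ^ 2 ∂μ := by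
  have h := ENNReal.lintegral_mul_le_Lp_mul_Lq μ Real.HolderConjugate.two_two hf hg
  simp only [Pi.mul_apply, ENNReal.rpow_two] at h
  refine (pow_le_pow_left' h 2).trans (le_of_eq ?_)
  rw [mul_pow, ← ENNReal.rpow_natCast, ← ENNReal.rpow_natCast, ← ENNReal.rpow_mul,
    ← ENNReal.rpow_mul]
  norm_num

lemma sq_lintegral_le {f : α → ℝ≥0∞} (hf : AEMeasurable f μ) :
    (∫⁻ x, f x ∂μ) ^ 2 ≤ μ univ * ∫⁻ x, f x ^ 2 ∂μ := by
  simpa using sq_lintegral_mul_le (aemeasurable_const (b := (1 : ℝ≥0∞))) hf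

lemma sq_eLpNorm_two (f : α → ℝ) : eLpNorm f 2 μ ^ 2 = ∫⁻ x, ‖f x‖ₑ ^ 2 ∂μ := by
  have := eLpNorm_nnreal_pow_eq_lintegral (μ := μ) (f := f) (p := 2) (by norm_num)
  simpa using this

lemma eLpNorm_two_lt_top_iff (f : α → ℝ) :
    eLpNorm f 2 μ < ∞ ↔ ∫⁻ x, ‖f x‖ₑ ^ 2 ∂μ < ∞ := by
  rw [← sq_eLpNorm_two, ENNReal.pow_lt_top_iff, or_iff_left two_ne_zero]

/-- Hölder's inequality for four factors, with exponents satisfying `1/p + 1/2 + 1/q + 1/q = 1`. -/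
lemma lintegral_mul_four_le {p q : ℝ≥0∞} (hpq : 1 / p + 2 / q = 1 / 2) {f g h k : α → ℝ}
    (hf : AEStronglyMeasurable f μ) (hg : AEStronglyMeasurable g μ)
    (hh : AEStronglyMeasurable h μ) (hk : AEStronglyMeasurable k μ) :
    ∫⁻ x, ‖f x‖ₑ * ‖g x‖ₑ * (‖h x‖ₑ * ‖k x‖ₑ) ∂μ
      ≤ eLpNorm f p μ * eLpNorm g 2 μ * (eLpNorm h q μ * eLpNorm k q μ) := by
  have : ENNReal.HolderTriple q q (q⁻¹ + q⁻¹)⁻¹ := ⟨by rw [inv_inv]⟩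
  have : ENNReal.HolderTriple p (q⁻¹ + q⁻¹)⁻¹ 2 := ⟨by
    rw [inv_inv, ← two_mul, ← div_eq_mul_inv, ← one_div, hpq, one_div]⟩
  have : ENNReal.HolderTriple 2 2 1 := ⟨by rw [ENNReal.inv_two_add_inv_two, inv_one]⟩
  have h1 := eLpNorm_smul_le_mul_eLpNorm (p := q) (q := q) (r := (q⁻¹ + q⁻¹)⁻¹) hk hh
  have h2 := eLpNorm_smul_le_mul_eLpNorm (p := p) (q := (q⁻¹ + q⁻¹)⁻¹) (r := 2) (hh.smul hk) hf
  have h3 := eLpNorm_smul_le_mul_eLpNorm (p := 2) (q := 2) (r := 1) (hf.smul (hh.smul hk)) hg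
  rw [eLpNorm_one_eq_lintegral_enorm] at h3
  calc ∫⁻ x, ‖f x‖ₑ * ‖g x‖ₑ * (‖h x‖ₑ * ‖k x‖ₑ) ∂μ
      = ∫⁻ x, ‖(g • f • h • k) x‖ₑ ∂μ := by
        refine lintegral_congr fun x => ?_
        simp only [Pi.smul_apply', smul_eq_mul, Pi.mul_apply, enorm_mul]
        ring
    _ ≤ eLpNorm g 2 μ * (eLpNorm f p μ * (eLpNorm h q μ * eLpNorm k q μ)) := by
        refine h3.trans ?_
        gcongr
        refine h2.trans ?_
        gcongr
    _ = _ := by ring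

lemma abs_exp_neg_sub_exp_neg_le (u v : ℝ) :
    |Real.exp (-u) - Real.exp (-v)| ≤ |u - v| * (Real.exp (-u) + Real.exp (-v)) := by
  wlog huv : u ≤ v generalizing u v
  · have := this v u (le_of_not_ge huv)
    rwa [abs_sub_comm, abs_sub_comm v u, add_comm] at this
  have h1 : Real.exp (-v) ≤ Real.exp (-u) := Real.exp_le_exp.2 (by linarith)
  have h2 : Real.exp (-u) * (1 - (v - u)) ≤ Real.exp (-v) := by
    have h3 := Real.add_one_le_exp (u - v)
    have h4 : Real.exp (-v) = Real.exp (-u) * Real.exp (u - v) := by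
      rw [← Real.exp_add]
      congr 1
      ring
    rw [h4]
    exact mul_le_mul_of_nonneg_left (by linarith) (Real.exp_pos _).le
  rw [abs_of_nonneg (by linarith), abs_sub_comm, abs_of_nonneg (by linarith)]
  nlinarith [Real.exp_pos (-v), mul_nonneg (sub_nonneg.2 huv) (Real.exp_pos (-v)).le]

end

/-! ### Stability of the mixture under perturbation of the coefficients -/

lemma enorm_primitive_sub_le {Ω : Type*} {t0 T : ℝ} {a a' : ℝ → Ω → ℝ} {ω : Ω}
    (ha : Integrable (fun s => a s ω) (timeMeasure t0 T))
    (ha' : Integrable (fun s => a' s ω) (timeMeasure t0 T)) {t : ℝ} (ht : t ∈ Icc t0 T) :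
    ‖primitive t0 a' t ω - primitive t0 a t ω‖ₑ
      ≤ ∫⁻ s, ‖a' s ω - a s ω‖ₑ ∂(timeMeasure t0 T) := by
  have h0 : t0 ∈ Icc t0 T := ⟨le_rfl, ht.1.trans ht.2⟩
  rw [primitive, primitive, ← intervalIntegral.integral_sub
    (intervalIntegrable_of_integrable ha' h0 ht) (intervalIntegrable_of_integrable ha h0 ht),
    intervalIntegral.integral_of_le ht.1]
  refine (enorm_integral_le_lintegral_enorm _).trans (lintegral_mono_set ?_)
  exact fun s hs => ⟨hs.1.le, hs.2.trans ht.2⟩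

variable {Ω : Type*} [MeasurableSpace Ω] {P : Measure Ω} {t0 T : ℝ} {a b a' b' : ℝ → Ω → ℝ}

lemma aemeasurable_enorm_sub [SFinite P] {a a' : ℝ → Ω → ℝ}
    (ha : AEStronglyMeasurable (fun z : ℝ × Ω => a z.1 z.2) ((timeMeasure t0 T).prod P))
    (ha' : AEStronglyMeasurable (fun z : ℝ × Ω => a' z.1 z.2) ((timeMeasure t0 T).prod P)) :
    AEMeasurable (fun z : ℝ × Ω => ‖a' z.1 z.2 - a z.1 z.2‖ₑ) ((timeMeasure t0 T).prod P) :=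
  (ha'.sub ha).enorm

lemma eLpNorm_primitive_sub_le [IsProbabilityMeasure P] (ha : IsPathIntegrable P t0 T a)
    (ha' : IsPathIntegrable P t0 T a') {t : ℝ} (ht : t ∈ Icc t0 T) :
    eLpNorm (fun ω => primitive t0 a' t ω - primitive t0 a t ω) 2 P
      ≤ scaledDist P t0 T a a' := by
  have hm := aemeasurable_enorm_sub ha.aesm ha'.aesm
  rw [scaledDist, ← ENNReal.pow_le_pow_left_iff two_ne_zero, mul_pow, sq_eLpNorm_two,
    sq_eLpNorm_two, ← ENNReal.rpow_natCast, ← ENNReal.rpow_mul,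
    lintegral_prod_symm _ (hm.pow_const 2),
    ← lintegral_const_mul' _ _ (by simp)]
  norm_num only [ENNReal.rpow_one]
  refine lintegral_mono_ae ?_
  filter_upwards [ha.integrable, ha'.integrable] with ω h1 h2
  refine (pow_le_pow_left' (enorm_primitive_sub_le h1 h2 ht) 2).trans (sq_lintegral_le ?_)
  exact (h2.aestronglyMeasurable.sub h1.aestronglyMeasurable).enorm

lemma aemeasurable_eLpNorm_two_sub [IsProbabilityMeasure P] {a a' : ℝ → Ω → ℝ}
    (ha : AEStronglyMeasurable (fun z : ℝ × Ω => a z.1 z.2) ((timeMeasure t0 T).prod P))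
    (ha' : AEStronglyMeasurable (fun z : ℝ × Ω => a' z.1 z.2) ((timeMeasure t0 T).prod P)) :
    AEMeasurable (fun s => eLpNorm (fun ω => a' s ω - a s ω) 2 P) (timeMeasure t0 T) := by
  have he : ∀ s, eLpNorm (fun ω => a' s ω - a s ω) 2 P
      = (∫⁻ ω, ‖a' s ω - a s ω‖ₑ ^ 2 ∂P) ^ (1 / 2 : ℝ) := by
    intro s
    rw [← sq_eLpNorm_two, ← ENNReal.rpow_natCast, ← ENNReal.rpow_mul]
    norm_num
  simp_rw [he]
  exact ((aemeasurable_enorm_sub ha ha').pow_const 2).lintegral_prod_right'.pow_const _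

lemma lintegral_eLpNorm_two_sub_le [IsProbabilityMeasure P] {a a' : ℝ → Ω → ℝ}
    (ha : AEStronglyMeasurable (fun z : ℝ × Ω => a z.1 z.2) ((timeMeasure t0 T).prod P))
    (ha' : AEStronglyMeasurable (fun z : ℝ × Ω => a' z.1 z.2) ((timeMeasure t0 T).prod P)) :
    ∫⁻ s, eLpNorm (fun ω => a' s ω - a s ω) 2 P ∂(timeMeasure t0 T)
      ≤ scaledDist P t0 T a a' := by
  rw [scaledDist, ← ENNReal.pow_le_pow_left_iff two_ne_zero, mul_pow, sq_eLpNorm_two,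
    ← ENNReal.rpow_natCast (_ ^ (1 / 2 : ℝ)), ← ENNReal.rpow_mul,
    lintegral_prod _ ((aemeasurable_enorm_sub ha ha').pow_const 2)]
  norm_num only [ENNReal.rpow_one]
  refine (sq_lintegral_le (aemeasurable_eLpNorm_two_sub ha ha')).trans (le_of_eq ?_)
  simp_rw [sq_eLpNorm_two]

/-- The discount factors are stable in mean, against a weight `f` in `L^p` and a weight `W` in
`L^q`. -/
lemma lintegral_mul_exp_sub_le [IsProbabilityMeasure P] {p q : ℝ≥0∞}
    (hpq : 1 / p + 2 / q = 1 / 2) (hq : 1 ≤ q)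
    (ha : IsPathIntegrable P t0 T a) (ha' : IsPathIntegrable P t0 T a') {C : ℝ≥0∞} {t : ℝ}
    (ht : t ∈ Icc t0 T)
    (hC : eLpNorm (fun ω => Real.exp (-primitive t0 a t ω)) q P ≤ C)
    (hC' : eLpNorm (fun ω => Real.exp (-primitive t0 a' t ω)) q P ≤ C)
    {f W : Ω → ℝ} (hf : AEStronglyMeasurable f P) (hW : AEStronglyMeasurable W P)
    (hWC : eLpNorm W q P ≤ C) :
    ∫⁻ ω, ‖f ω‖ₑ * ‖Real.exp (-primitive t0 a' t ω) - Real.exp (-primitive t0 a t ω)‖ₑ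
        * ‖W ω‖ₑ ∂P
      ≤ eLpNorm f p P * (scaledDist P t0 T a a' * ((C + C) * C)) := by
  have hK := aestronglyMeasurable_primitive_apply ha.aesm ht
  have hK' := aestronglyMeasurable_primitive_apply ha'.aesm ht
  have hE := Real.continuous_exp.comp_aestronglyMeasurable hK.neg
  have hE' := Real.continuous_exp.comp_aestronglyMeasurable hK'.neg
  have hsum : eLpNorm (fun ω => Real.exp (-primitive t0 a' t ω)
      + Real.exp (-primitive t0 a t ω)) q P ≤ C + C :=
    (eLpNorm_add_le hE' hE hq).trans (add_le_add hC' hC)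
  calc _ ≤ ∫⁻ ω, ‖f ω‖ₑ * ‖primitive t0 a' t ω - primitive t0 a t ω‖ₑ
        * (‖Real.exp (-primitive t0 a' t ω) + Real.exp (-primitive t0 a t ω)‖ₑ * ‖W ω‖ₑ) ∂P := by
        refine lintegral_mono fun ω => ?_
        rw [mul_assoc, mul_assoc]
        gcongr ‖f ω‖ₑ * ?_
        rw [← mul_assoc]
        gcongr
        rw [← enorm_mul, Real.enorm_eq_ofReal_abs, Real.enorm_eq_ofReal_abs, abs_mul]
        refine ENNReal.ofReal_le_ofReal ((abs_exp_neg_sub_exp_neg_le _ _).trans (le_of_eq ?_))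
        rw [abs_of_pos (a := _ + _) (by positivity)]
    _ ≤ _ := lintegral_mul_four_le hpq hf (hK'.sub hK) (hE'.add hE) hW
    _ ≤ _ := by
        rw [mul_assoc]
        gcongr
        exact eLpNorm_primitive_sub_le ha ha' ht

lemma eLpNorm_one_const [IsProbabilityMeasure P] {p : ℝ≥0∞} :
    eLpNorm (fun _ : Ω => (1 : ℝ)) p P ≤ 1 := by
  rcases eq_or_ne p 0 with rfl | hp
  · simp
  · rw [eLpNorm_const _ hp (IsProbabilityMeasure.ne_zero P)]
    simp

/-- The discounted inhomogeneity is stable in mean, against a weight `W` in `L^q`. -/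
lemma lintegral_discounted_sub_mul_le [IsProbabilityMeasure P] (hT : t0 ≤ T) {p q : ℝ≥0∞}
    (hpq : 1 / p + 2 / q = 1 / 2) (hq : 1 ≤ q)
    (ha : IsPathIntegrable P t0 T a) (ha' : IsPathIntegrable P t0 T a')
    (hb : IsPathIntegrable P t0 T b) (hb' : IsPathIntegrable P t0 T b') {C : ℝ≥0} {D : ℝ≥0∞}
    (hfin : scaledDist P t0 T a a' ≠ ∞)
    (hC : ∀ t ∈ Icc t0 T, eLpNorm (fun ω => Real.exp (-primitive t0 a t ω)) q P ≤ C)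
    (hC' : ∀ t ∈ Icc t0 T, eLpNorm (fun ω => Real.exp (-primitive t0 a' t ω)) q P ≤ C)
    (hD : ∫⁻ s, eLpNorm (b' s) p P ∂(timeMeasure t0 T) ≤ D)
    {W : Ω → ℝ} (hW : AEStronglyMeasurable W P) (hWC : eLpNorm W q P ≤ C)
    {t : ℝ} (ht : t ∈ Icc t0 T) :
    ∫⁻ ω, ‖discounted t0 a' b' t ω - discounted t0 a b t ω‖ₑ * ‖W ω‖ₑ ∂P
      ≤ D * (scaledDist P t0 T a a' * ((C + C) * C))
      + scaledDist P t0 T b b'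
        * (C * C) := by
  have hE := (Real.continuous_exp.comp_aestronglyMeasurable
    (aestronglyMeasurable_primitive ha.aesm).neg)
  have hE' := (Real.continuous_exp.comp_aestronglyMeasurable
    (aestronglyMeasurable_primitive ha'.aesm).neg)
  have hW2 : AEStronglyMeasurable (fun z : ℝ × Ω => W z.2) ((timeMeasure t0 T).prod P) :=
    hW.comp_quasiMeasurePreserving Measure.quasiMeasurePreserving_snd
  have hm1 : AEMeasurable (fun z : ℝ × Ω => ‖b' z.1 z.2‖ₑ
      * ‖Real.exp (-primitive t0 a' z.1 z.2) - Real.exp (-primitive t0 a z.1 z.2)‖ₑ * ‖W z.2‖ₑ)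
      ((timeMeasure t0 T).prod P) :=
    (hb'.aesm.enorm.mul (hE'.sub hE).enorm).mul hW2.enorm
  have hm2 : AEMeasurable (fun z : ℝ × Ω => ‖(1 : ℝ)‖ₑ * ‖b' z.1 z.2 - b z.1 z.2‖ₑ
      * (‖Real.exp (-primitive t0 a z.1 z.2)‖ₑ * ‖W z.2‖ₑ)) ((timeMeasure t0 T).prod P) :=
    (aemeasurable_const.mul (hb'.aesm.sub hb.aesm).enorm).mul (hE.enorm.mul hW2.enorm)
  -- the first factor `b'` is the one that is bounded in `L^p`; the other summand only needs `L²`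
  have key : ∀ᵐ ω ∂P, ‖discounted t0 a' b' t ω - discounted t0 a b t ω‖ₑ * ‖W ω‖ₑ
      ≤ ∫⁻ s, (‖b' s ω‖ₑ * ‖Real.exp (-primitive t0 a' s ω) - Real.exp (-primitive t0 a s ω)‖ₑ
            * ‖W ω‖ₑ
          + ‖(1 : ℝ)‖ₑ * ‖b' s ω - b s ω‖ₑ
            * (‖Real.exp (-primitive t0 a s ω)‖ₑ * ‖W ω‖ₑ)) ∂(timeMeasure t0 T) := by
    filter_upwards [ha.integrable, ha'.integrable, hb.integrable, hb'.integrable]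
      with ω h1 h2 h3 h4
    refine (mul_le_mul_left (enorm_primitive_sub_le (integrable_mul_exp_neg_primitive hT h1 h3)
      (integrable_mul_exp_neg_primitive hT h2 h4) ht) _).trans ?_
    rw [← lintegral_mul_const' _ _ enorm_ne_top]
    refine lintegral_mono fun s => ?_
    have h5 : b' s ω * Real.exp (-primitive t0 a' s ω) - b s ω * Real.exp (-primitive t0 a s ω)
        = b' s ω * (Real.exp (-primitive t0 a' s ω) - Real.exp (-primitive t0 a s ω))
          + (b' s ω - b s ω) * Real.exp (-primitive t0 a s ω) := by ring
    rw [h5, enorm_one, one_mul, ← mul_assoc, ← add_mul]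
    refine mul_le_mul_left ((enorm_add_le _ _).trans (le_of_eq ?_)) _
    rw [enorm_mul, enorm_mul]
  refine (lintegral_mono_ae key).trans ?_
  rw [lintegral_lintegral_swap (hm1.add hm2).prod_swap]
  have h6 : ∀ᵐ s ∂(timeMeasure t0 T),
      ∫⁻ ω, (‖b' s ω‖ₑ * ‖Real.exp (-primitive t0 a' s ω) - Real.exp (-primitive t0 a s ω)‖ₑ
            * ‖W ω‖ₑ
          + ‖(1 : ℝ)‖ₑ * ‖b' s ω - b s ω‖ₑ
            * (‖Real.exp (-primitive t0 a s ω)‖ₑ * ‖W ω‖ₑ)) ∂P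
      ≤ eLpNorm (b' s) p P * (scaledDist P t0 T a a' * ((C + C) * C))
        + eLpNorm (fun ω => b' s ω - b s ω) 2 P * (C * C) := by
    filter_upwards [hb.aesm.prodMk_left, hb'.aesm.prodMk_left,
      ae_timeMeasure_of_forall (p := fun s => s ∈ Icc t0 T) fun s hs => hs] with s h1 h2 hs
    have hEs := Real.continuous_exp.comp_aestronglyMeasurable
      (aestronglyMeasurable_primitive_apply ha.aesm hs).neg
    have hEs' := Real.continuous_exp.comp_aestronglyMeasurable
      (aestronglyMeasurable_primitive_apply ha'.aesm hs).neg
    have hm3 : AEMeasurable (fun ω => ‖b' s ω‖ₑ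
        * ‖Real.exp (-primitive t0 a' s ω) - Real.exp (-primitive t0 a s ω)‖ₑ * ‖W ω‖ₑ) P :=
      (h2.enorm.mul (hEs'.sub hEs).enorm).mul hW.enorm
    rw [lintegral_add_left' hm3]
    refine add_le_add
      (lintegral_mul_exp_sub_le hpq hq ha ha' hs (hC s hs) (hC' s hs) h2 hW hWC) ?_
    refine (lintegral_mul_four_le hpq aestronglyMeasurable_const (h2.sub h1) hEs hW).trans ?_
    calc _ ≤ 1 * eLpNorm (fun ω => b' s ω - b s ω) 2 P * (C * C) := by
          gcongr
          · exact eLpNorm_one_const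
          · exact le_rfl
          · exact hC s hs
      _ = _ := by rw [one_mul]
  refine (lintegral_mono_ae h6).trans ?_
  rw [lintegral_add_right' _ ((aemeasurable_eLpNorm_two_sub hb.aesm hb'.aesm).mul_const _),
    lintegral_mul_const' _ _ (by finiteness), lintegral_mul_const' _ _ (by finiteness)]
  gcongr
  exact lintegral_eLpNorm_two_sub_le hb.aesm hb'.aesm

/-- Stability of the mixture: its dependence on the coefficients is Lipschitz in `L²`, uniformly in
time and locally uniformly in the space variable. -/
lemma enorm_mixDensity_sub_le [IsProbabilityMeasure P] (hT : t0 ≤ T) {p q : ℝ≥0∞}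
    (hpq : 1 / p + 2 / q = 1 / 2) (hq : 1 ≤ q)
    (ha : IsPathIntegrable P t0 T a) (ha' : IsPathIntegrable P t0 T a')
    (hb : IsPathIntegrable P t0 T b) (hb' : IsPathIntegrable P t0 T b') {C : ℝ≥0} {D : ℝ≥0∞}
    (hC1 : 1 ≤ C) (hfin : scaledDist P t0 T a a' ≠ ∞)
    (hC : ∀ t ∈ Icc t0 T, eLpNorm (fun ω => Real.exp (-primitive t0 a t ω)) q P ≤ C)
    (hC' : ∀ t ∈ Icc t0 T, eLpNorm (fun ω => Real.exp (-primitive t0 a' t ω)) q P ≤ C)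
    (hD : ∫⁻ s, eLpNorm (b' s) p P ∂(timeMeasure t0 T) ≤ D)
    {f0 : ℝ → ℝ} {L M : ℝ≥0} (hL : LipschitzWith L f0) (hpos : ∀ x, 0 ≤ f0 x)
    (hM : ∀ x, f0 x ≤ M) (x : ℝ) {t : ℝ} (ht : t ∈ Icc t0 T) :
    ‖mixDensity P t0 a' b' f0 x t - mixDensity P t0 a b f0 x t‖ₑ
      ≤ L * (‖x‖ₑ * (scaledDist P t0 T a a' * ((C + C) * C))
          + (D * (scaledDist P t0 T a a' * ((C + C) * C)) + scaledDist P t0 T b b' * (C * C)))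
        + M * (scaledDist P t0 T a a' * ((C + C) * C)) := by
  have hE : AEStronglyMeasurable (fun ω => Real.exp (-primitive t0 a t ω)) P :=
    Real.continuous_exp.comp_aestronglyMeasurable
      (aestronglyMeasurable_primitive_apply ha.aesm ht).neg
  have hE' : AEStronglyMeasurable (fun ω => Real.exp (-primitive t0 a' t ω)) P :=
    Real.continuous_exp.comp_aestronglyMeasurable
      (aestronglyMeasurable_primitive_apply ha'.aesm ht).neg
  have hB := aestronglyMeasurable_discounted_apply ha.aesm hb.aesm ht
  have hB' := aestronglyMeasurable_discounted_apply ha'.aesm hb'.aesm ht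
  have hEi : Integrable (fun ω => Real.exp (-primitive t0 a t ω)) P :=
    MemLp.integrable hq ⟨hE, (hC t ht).trans_lt ENNReal.coe_lt_top⟩
  have hEi' : Integrable (fun ω => Real.exp (-primitive t0 a' t ω)) P :=
    MemLp.integrable hq ⟨hE', (hC' t ht).trans_lt ENNReal.coe_lt_top⟩
  have h1C : eLpNorm (fun _ : Ω => (1 : ℝ)) q P ≤ C :=
    eLpNorm_one_const.trans (by exact_mod_cast hC1)
  have e1 := lintegral_mul_exp_sub_le hpq hq ha ha' ht (hC t ht) (hC' t ht)
    (f := fun _ => 1) aestronglyMeasurable_const hE' (hC' t ht)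
  have e2 := lintegral_mul_exp_sub_le hpq hq ha ha' ht (hC t ht) (hC' t ht)
    (f := fun _ => 1) aestronglyMeasurable_const (W := fun _ => 1) aestronglyMeasurable_const h1C
  have e3 := lintegral_discounted_sub_mul_le hT hpq hq ha ha' hb hb' hfin hC hC' hD hE' (hC' t ht)
    ht
  have e1' := e1.trans (mul_le_mul_left (eLpNorm_one_const (P := P)) _)
  have e2' := e2.trans (mul_le_mul_left (eLpNorm_one_const (P := P)) _)
  simp only [enorm_one, one_mul, mul_one] at e1' e2'
  have hm1 : AEMeasurable (fun ω => ‖x‖ₑ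
      * (‖Real.exp (-primitive t0 a' t ω) - Real.exp (-primitive t0 a t ω)‖ₑ
        * ‖Real.exp (-primitive t0 a' t ω)‖ₑ)) P :=
    ((hE'.sub hE).enorm.mul hE'.enorm).const_mul _
  have hm3 : AEMeasurable (fun ω => (M : ℝ≥0∞)
      * ‖Real.exp (-primitive t0 a' t ω) - Real.exp (-primitive t0 a t ω)‖ₑ) P :=
    (hE'.sub hE).enorm.const_mul _
  rw [mixDensity, mixDensity, ← integral_sub
    (integrable_mix hL.continuous hpos hM hB' hEi' x)
    (integrable_mix hL.continuous hpos hM hB hEi x)]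
  refine (enorm_integral_le_lintegral_enorm _).trans ?_
  have hpt : ∀ ω, ‖f0 (x * Real.exp (-primitive t0 a' t ω) - discounted t0 a' b' t ω)
        * Real.exp (-primitive t0 a' t ω)
      - f0 (x * Real.exp (-primitive t0 a t ω) - discounted t0 a b t ω)
        * Real.exp (-primitive t0 a t ω)‖ₑ
      ≤ L * (‖x‖ₑ * (‖Real.exp (-primitive t0 a' t ω) - Real.exp (-primitive t0 a t ω)‖ₑ
          * ‖Real.exp (-primitive t0 a' t ω)‖ₑ)
          + ‖discounted t0 a' b' t ω - discounted t0 a b t ω‖ₑ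
            * ‖Real.exp (-primitive t0 a' t ω)‖ₑ)
        + M * ‖Real.exp (-primitive t0 a' t ω) - Real.exp (-primitive t0 a t ω)‖ₑ := by
    intro ω
    generalize Real.exp (-primitive t0 a' t ω) = u'
    generalize Real.exp (-primitive t0 a t ω) = u
    generalize discounted t0 a' b' t ω = v'
    generalize discounted t0 a b t ω = v
    have h1 : f0 (x * u' - v') * u' - f0 (x * u - v) * u
        = (f0 (x * u' - v') - f0 (x * u - v)) * u' + f0 (x * u - v) * (u' - u) := by ring
    have h2 : ‖f0 (x * u' - v') - f0 (x * u - v)‖ₑ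
        ≤ L * (‖x‖ₑ * ‖u' - u‖ₑ + ‖v' - v‖ₑ) := by
      have := hL (x * u' - v') (x * u - v)
      rw [edist_eq_enorm_sub, edist_eq_enorm_sub] at this
      refine this.trans ?_
      gcongr
      rw [← enorm_mul]
      refine le_trans (le_of_eq ?_) (enorm_sub_le (a := x * (u' - u)) (b := v' - v))
      congr 1
      ring
    have h3 : ‖f0 (x * u - v)‖ₑ ≤ M := by
      rw [Real.enorm_eq_ofReal (hpos _)]
      exact ENNReal.ofReal_le_of_le_toReal (hM _)
    calc _ ≤ ‖f0 (x * u' - v') - f0 (x * u - v)‖ₑ * ‖u'‖ₑ + ‖f0 (x * u - v)‖ₑ * ‖u' - u‖ₑ := by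
          rw [h1, ← enorm_mul, ← enorm_mul]
          exact enorm_add_le _ _
      _ ≤ L * (‖x‖ₑ * ‖u' - u‖ₑ + ‖v' - v‖ₑ) * ‖u'‖ₑ + M * ‖u' - u‖ₑ := by gcongr
      _ = _ := by ring
  refine (lintegral_mono hpt).trans ?_
  rw [lintegral_add_right' _ hm3, lintegral_const_mul' _ _ ENNReal.coe_ne_top,
    lintegral_const_mul' _ _ ENNReal.coe_ne_top, lintegral_add_left' hm1,
    lintegral_const_mul' _ _ enorm_ne_top]
  gcongr

end

section

/-! ### Orthonormal expansions -/

section Hilbert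

variable {E : Type*} [NormedAddCommGroup E] [InnerProductSpace ℝ E]

/-- In a separable Hilbert space, a vector is the sum of its expansion along an orthonormal family as
soon as it is orthogonal to countably many suitable vectors of the orthogonal complement of the
family. Countability matters because each of these conditions will only hold almost surely. -/
lemma exists_seq_hasSum_of_orthonormal [CompleteSpace E] [SecondCountableTopology E]
    {ι : Type*} {v : ι → E} (hv : Orthonormal ℝ v) :
    ∃ d : ℕ → E, (∀ n j, inner ℝ (v j) (d n) = 0) ∧
      ∀ y, (∀ n, inner ℝ (d n) y = 0) → HasSum (fun j => inner ℝ (v j) y • v j) y := by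
  -- a dense sequence in the orthogonal complement of the family
  let U : Set E := {x | ∀ j, inner ℝ (v j) x = 0}
  have : Nonempty U := ⟨⟨0, fun j => inner_zero_right _⟩⟩
  refine ⟨fun n => TopologicalSpace.denseSeq U n,
    fun n => (TopologicalSpace.denseSeq U n).2, fun y hy => ?_⟩
  have hU : ∀ x : U, inner ℝ (x : E) y = 0 := by
    have hcl : IsClosed {x : U | inner ℝ (x : E) y = 0} :=
      isClosed_eq (continuous_subtype_val.inner continuous_const) continuous_const
    have := hcl.closure_subset_iff.2 (range_subset_iff.2 hy)
    rw [(TopologicalSpace.denseRange_denseSeq U).closure_range] at this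
    exact fun x => this (mem_univ x)
  obtain ⟨w, b, hw, hb⟩ := hv.toSubtypeRange.exists_hilbertBasis_extension
  let e : ι → w := fun j => ⟨v j, hw (mem_range_self j)⟩
  have he : Function.Injective e := fun i j hij =>
    hv.linearIndependent.injective (congrArg Subtype.val hij)
  have h1 := b.hasSum_repr y
  have hbw : Orthonormal ℝ (Subtype.val : w → E) := hb ▸ b.orthonormal
  have h2 : ∀ i : w, b.repr y i • b i = inner ℝ (i : E) y • (i : E) := by
    intro i
    rw [b.repr_apply_apply, hb]
  simp_rw [h2] at h1
  refine (he.hasSum_iff (f := fun i : w => inner ℝ (i : E) y • (i : E)) fun i hi => ?_).2 h1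
  have : inner ℝ (i : E) y = 0 := by
    refine hU ⟨i, fun j => ?_⟩
    exact hbw.2 (i := e j) (j := i) fun h => hi ⟨j, h⟩
  rw [this, zero_smul]

lemma norm_sum_inner_smul_sub_le {ι : Type*} [Fintype ι] {v : ι → E} (hv : Orthonormal ℝ v)
    (y : E) : ‖∑ j, inner ℝ (v j) y • v j - y‖ ≤ ‖y‖ := by
  set p := ∑ j, inner ℝ (v j) y • v j with hp
  have h1 : inner ℝ p (y - p) = 0 := by
    rw [hp, sum_inner]
    refine Finset.sum_eq_zero fun i _ => ?_
    rw [inner_smul_left, inner_sub_right, hv.inner_right_fintype, sub_self, mul_zero]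
  have h2 := norm_add_sq_eq_norm_sq_add_norm_sq_of_inner_eq_zero p (y - p) h1
  rw [add_sub_cancel] at h2
  rw [norm_sub_rev]
  nlinarith [norm_nonneg y, norm_nonneg (y - p), mul_self_nonneg ‖p‖]

end Hilbert

lemma lt_numTerms_iff {J : ℕ∞} {N j : ℕ} : j < numTerms J N ↔ j < N ∧ (j : ℕ∞) < J := by
  have h : ((numTerms J N : ℕ) : ℕ∞) = min (N : ℕ∞) J :=
    ENat.natCast_toNat (ne_top_of_le_ne_top (ENat.natCast_ne_top N) (min_le_left _ _))
  rw [← Nat.cast_lt (α := ℕ∞), h, lt_min_iff, Nat.cast_lt]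

/-- The partial sums over the first `numTerms J N` terms of a convergent series indexed by `j < J`
converge. -/
lemma tendsto_sum_numTerms {E : Type*} [AddCommMonoid E] [TopologicalSpace E] {J : ℕ∞}
    {g : {j : ℕ // (j : ℕ∞) < J} → E} {y : E} (h : HasSum g y) :
    Tendsto (fun N => ∑ j : Fin (numTerms J N), g ⟨j, (lt_numTerms_iff.1 j.2).2⟩) atTop (𝓝 y) := by
  let e (N : ℕ) : Fin (numTerms J N) ↪ {j : ℕ // (j : ℕ∞) < J} :=
    ⟨fun j => ⟨j, (lt_numTerms_iff.1 j.2).2⟩, fun i j hij => Fin.ext (congrArg Subtype.val hij)⟩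
  have hmem : ∀ N (j : {j : ℕ // (j : ℕ∞) < J}), j ∈ Finset.univ.map (e N) ↔ j.1 < N := by
    intro N j
    simp only [Finset.mem_map, Finset.mem_univ, true_and]
    constructor
    · rintro ⟨i, rfl⟩
      exact (lt_numTerms_iff.1 i.2).1
    · intro hj
      exact ⟨⟨j.1, lt_numTerms_iff.2 ⟨hj, j.2⟩⟩, rfl⟩
  have ht : Tendsto (fun N => Finset.univ.map (e N)) atTop atTop := by
    refine tendsto_atTop_finset_of_monotone (fun N N' hN j hj => ?_) fun j => ?_
    · exact (hmem _ _).2 (((hmem _ _).1 hj).trans_le hN)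
    · exact ⟨j.1 + 1, (hmem _ _).2 (Nat.lt_succ_self _)⟩
  refine (h.comp ht).congr fun N => ?_
  simp only [Function.comp_apply, Finset.sum_map]
  rfl

/-! ### Karhunen–Loève expansions converge in `L²` -/

variable {Ω : Type*} [MeasurableSpace Ω] {P : Measure Ω} {t0 T : ℝ} {X : ℝ → Ω → ℝ} {J : ℕ∞}
  {ν : ℕ → ℝ} {φ : ℕ → ℝ → ℝ} {ξ : ℕ → Ω → ℝ}

lemma memLp_meanFun [IsProbabilityMeasure P]
    (hX : MemLp (fun z : ℝ × Ω => X z.1 z.2) 2 ((timeMeasure t0 T).prod P)) :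
    MemLp (meanFun P X) 2 (timeMeasure t0 T) := by
  refine ⟨hX.1.integral_prod_right', ?_⟩
  rw [eLpNorm_two_lt_top_iff]
  have h2 := hX.2
  rw [eLpNorm_two_lt_top_iff,
    lintegral_prod _ (hX.1.enorm.pow_const 2)] at h2
  refine (lintegral_mono_ae ?_).trans_lt h2
  filter_upwards [hX.1.prodMk_left] with s hs
  refine (pow_le_pow_left' (enorm_integral_le_lintegral_enorm _) 2).trans ?_
  simpa using sq_lintegral_le hs.enorm

lemma memLp_sub_meanFun [IsProbabilityMeasure P]
    (hX : MemLp (fun z : ℝ × Ω => X z.1 z.2) 2 ((timeMeasure t0 T).prod P)) :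
    MemLp (fun z : ℝ × Ω => X z.1 z.2 - meanFun P X z.1) 2 ((timeMeasure t0 T).prod P) :=
  hX.sub ((memLp_meanFun hX).comp_fst P)

lemma ae_memLp_two_path [IsProbabilityMeasure P] {Y : ℝ → Ω → ℝ}
    (hY : MemLp (fun z : ℝ × Ω => Y z.1 z.2) 2 ((timeMeasure t0 T).prod P)) :
    ∀ᵐ ω ∂P, MemLp (fun s => Y s ω) 2 (timeMeasure t0 T) := by
  have h2 := hY.2
  rw [eLpNorm_two_lt_top_iff,
    lintegral_prod_symm _ (hY.1.enorm.pow_const 2)] at h2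
  have h3 := ae_lt_top' (hY.1.enorm.pow_const 2).lintegral_prod_left' h2.ne
  filter_upwards [h3, hY.1.prod_swap.prodMk_left] with ω h4 h5
  refine ⟨h5, ?_⟩
  rwa [eLpNorm_two_lt_top_iff]

lemma isPathIntegrable_of_memLp_two [IsProbabilityMeasure P]
    (hX : MemLp (fun z : ℝ × Ω => X z.1 z.2) 2 ((timeMeasure t0 T).prod P)) :
    IsPathIntegrable P t0 T X where
  aesm := hX.1
  integrable := (ae_memLp_two_path hX).mono fun _ h => h.integrable one_le_two

/-- The second moment of `∫ (X(s) - E[X(s)]) f(s) ds` is the quadratic form of the covariance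
operator at `f`, so it vanishes if the operator annihilates `f`. -/
lemma ae_integral_mul_eq_zero_of_covOp [IsProbabilityMeasure P]
    (hX : MemLp (fun z : ℝ × Ω => X z.1 z.2) 2 ((timeMeasure t0 T).prod P)) {f : ℝ → ℝ}
    (hf : MemLp f 2 (timeMeasure t0 T))
    (hcov : ∀ᵐ t ∂(timeMeasure t0 T), covOp P t0 T X f t = 0) :
    ∀ᵐ ω ∂P, ∫ s, (X s ω - meanFun P X s) * f s ∂(timeMeasure t0 T) = 0 := by
  have hY := memLp_sub_meanFun hX
  have hY2 := hY.2
  rw [eLpNorm_two_lt_top_iff,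
    lintegral_prod_symm _ (hY.1.enorm.pow_const 2)] at hY2
  have hf2 := hf.2
  rw [eLpNorm_two_lt_top_iff] at hf2
  set τ := timeMeasure t0 T with hτ
  set Y : ℝ → Ω → ℝ := fun s ω => X s ω - meanFun P X s with hYdef
  let G : Ω × (ℝ × ℝ) → ℝ := fun z =>
    (Y z.2.1 z.1 * f z.2.1) * (Y z.2.2 z.1 * f z.2.2)
  have hYf : AEStronglyMeasurable (fun z : Ω × ℝ => Y z.2 z.1 * f z.2) (P.prod τ) :=
    hY.1.prod_swap.mul hf.1.comp_snd
  have hq1 : Measure.QuasiMeasurePreserving (fun z : Ω × (ℝ × ℝ) => (z.1, z.2.1))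
      (P.prod (τ.prod τ)) (P.prod τ) :=
    QuasiMeasurePreserving.prodMap (Measure.QuasiMeasurePreserving.id _)
      Measure.quasiMeasurePreserving_fst
  have hq2 : Measure.QuasiMeasurePreserving (fun z : Ω × (ℝ × ℝ) => (z.1, z.2.2))
      (P.prod (τ.prod τ)) (P.prod τ) :=
    QuasiMeasurePreserving.prodMap (Measure.QuasiMeasurePreserving.id _)
      Measure.quasiMeasurePreserving_snd
  have hGm : AEStronglyMeasurable G (P.prod (τ.prod τ)) :=
    (hYf.comp_quasiMeasurePreserving hq1).mul (hYf.comp_quasiMeasurePreserving hq2)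
  have hG : Integrable G (P.prod (τ.prod τ)) := by
    refine ⟨hGm, ?_⟩
    rw [HasFiniteIntegral, lintegral_prod _ hGm.enorm]
    have h1 : ∀ᵐ ω ∂P, ∫⁻ z, ‖G (ω, z)‖ₑ ∂(τ.prod τ)
        ≤ (∫⁻ s, ‖Y s ω‖ₑ ^ 2 ∂τ) * ∫⁻ s, ‖f s‖ₑ ^ 2 ∂τ := by
      filter_upwards [hY.1.prod_swap.prodMk_left] with ω hω
      have hω' : AEMeasurable (fun s => ‖Y s ω * f s‖ₑ) τ := (hω.mul hf.1).enorm
      calc ∫⁻ z, ‖G (ω, z)‖ₑ ∂(τ.prod τ)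
          = ∫⁻ z : ℝ × ℝ, ‖Y z.1 ω * f z.1‖ₑ * ‖Y z.2 ω * f z.2‖ₑ ∂(τ.prod τ) := by
            simp only [G, enorm_mul]
        _ = (∫⁻ s, ‖Y s ω‖ₑ * ‖f s‖ₑ ∂τ) ^ 2 := by
            rw [lintegral_prod_mul hω' hω', sq]
            simp only [enorm_mul]
        _ ≤ _ := sq_lintegral_mul_le hω.enorm hf.1.enorm
    refine (lintegral_mono_ae h1).trans_lt ?_
    rw [lintegral_mul_const' _ _ hf2.ne]
    exact ENNReal.mul_lt_top hY2 hf2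
  have hZ : ∀ ω, ∫ z, G (ω, z) ∂(τ.prod τ) = (∫ s, Y s ω * f s ∂τ) ^ 2 := by
    intro ω
    rw [sq]
    exact integral_prod_mul (fun s => Y s ω * f s) (fun s => Y s ω * f s)
  have hcovG : ∀ z : ℝ × ℝ, ∫ ω, G (ω, z) ∂P
      = f z.1 * (covariance (X z.1) (X z.2) P * f z.2) := by
    intro z
    have : ∀ ω, G (ω, z) = (f z.1 * f z.2) * (Y z.1 ω * Y z.2 ω) := fun ω => by
      simp only [G]
      ring
    simp_rw [this]
    rw [integral_const_mul, covariance]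
    simp only [Y, meanFun]
    ring
  -- expand the square as a double integral and take the expectation first
  have hzero : ∫ ω, (∫ s, Y s ω * f s ∂τ) ^ 2 ∂P = 0 := by
    simp_rw [← hZ]
    rw [integral_integral_swap (f := fun ω z => G (ω, z)) hG,
      integral_prod _ hG.integral_prod_right]
    simp_rw [hcovG]
    refine integral_eq_zero_of_ae ?_
    filter_upwards [hcov] with t ht
    rw [integral_const_mul]
    simp only [covOp] at ht
    rw [ht, mul_zero]
    rfl
  have hint : Integrable (fun ω => (∫ s, Y s ω * f s ∂τ) ^ 2) P := by
    simp_rw [← hZ]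
    exact hG.integral_prod_left
  rw [integral_eq_zero_iff_of_nonneg (fun ω => sq_nonneg _) hint] at hzero
  filter_upwards [hzero] with ω hω
  exact pow_eq_zero_iff two_ne_zero |>.1 hω

end

section

variable {Ω : Type*} [MeasurableSpace Ω] {P : Measure Ω} {t0 T : ℝ} {X : ℝ → Ω → ℝ} {J : ℕ∞}
  {ν : ℕ → ℝ} {φ : ℕ → ℝ → ℝ} {ξ : ℕ → Ω → ℝ}

lemma inner_toLp_toLp {α : Type*} [MeasurableSpace α] {μ : Measure α} {f g : α → ℝ}
    (hf : MemLp f 2 μ) (hg : MemLp g 2 μ) :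
    inner ℝ (hf.toLp f) (hg.toLp g) = ∫ x, f x * g x ∂μ := by
  rw [L2.inner_def]
  refine integral_congr_ae ?_
  filter_upwards [hf.coeFn_toLp, hg.coeFn_toLp] with x h1 h2
  rw [h1, h2, real_inner_comm]
  rfl

/-- A truncated sum of deterministic integrable functions with random coefficients. -/
lemma isPathIntegrable_klSum [IsProbabilityMeasure P] {m : ℝ → ℝ}
    (hm : Integrable m (timeMeasure t0 T)) {n : ℕ}
    (hφ : ∀ j : Fin n, Integrable (φ j) (timeMeasure t0 T)) {Z : Ω → Fin n → ℝ}
    (hZ : AEMeasurable Z P) :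
    IsPathIntegrable P t0 T (fun s ω => klSum m ν φ (Z ω) s) where
  aesm := by
    refine hm.aestronglyMeasurable.comp_fst.add
      (Finset.aestronglyMeasurable_fun_sum _ fun j _ => ?_)
    exact ((hφ j).aestronglyMeasurable.comp_fst.const_mul _).mul
      ((measurable_pi_apply j).comp_aemeasurable hZ).aestronglyMeasurable.comp_snd
  integrable := Eventually.of_forall fun ω =>
    hm.add (integrable_finsetSum _ fun j _ => ((hφ j).const_mul _).mul_const _)

lemma IsKarhunenLoeve.integrable_eigenfunction (h : IsKarhunenLoeve P t0 T X J ν φ ξ) {N : ℕ}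
    (j : Fin (numTerms J N)) : Integrable (φ j) (timeMeasure t0 T) :=
  (h.memLp_eigenfunction j (lt_numTerms_iff.1 j.2).2).integrable one_le_two

lemma IsKarhunenLoeve.aemeasurable_headVec (h : IsKarhunenLoeve P t0 T X J ν φ ξ) (N : ℕ) :
    AEMeasurable (headVec ξ (numTerms J N)) P :=
  aemeasurable_pi_lambda _ fun j =>
    (h.memLp_coeff j (lt_numTerms_iff.1 j.2).2).aestronglyMeasurable.aemeasurable

lemma IsKarhunenLoeve.isPathIntegrable_klTrunc [IsProbabilityMeasure P]
    (h : IsKarhunenLoeve P t0 T X J ν φ ξ)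
    (hX : MemLp (fun z : ℝ × Ω => X z.1 z.2) 2 ((timeMeasure t0 T).prod P)) (N : ℕ) :
    IsPathIntegrable P t0 T (klTrunc P X J ν φ ξ N) :=
  isPathIntegrable_klSum ((memLp_meanFun hX).integrable one_le_two)
    (fun j => h.integrable_eigenfunction j) (h.aemeasurable_headVec N)

/-- Almost every path of the truncation error is the remainder of the orthogonal expansion of the
centered path, hence tends to zero in `L²([t0, T])` and is dominated by the centered path. -/
lemma IsKarhunenLoeve.ae_eLpNorm_path [IsProbabilityMeasure P]
    (h : IsKarhunenLoeve P t0 T X J ν φ ξ)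
    (hX : MemLp (fun z : ℝ × Ω => X z.1 z.2) 2 ((timeMeasure t0 T).prod P)) :
    ∀ᵐ ω ∂P,
      Tendsto (fun N => eLpNorm (fun s => klTrunc P X J ν φ ξ N s ω - X s ω) 2
        (timeMeasure t0 T)) atTop (𝓝 0) ∧
      ∀ N, eLpNorm (fun s => klTrunc P X J ν φ ξ N s ω - X s ω) 2 (timeMeasure t0 T)
        ≤ eLpNorm (fun s => X s ω - meanFun P X s) 2 (timeMeasure t0 T) := by
  let v : {j : ℕ // (j : ℕ∞) < J} → Lp ℝ 2 (timeMeasure t0 T) :=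
    fun j => (h.memLp_eigenfunction j j.2).toLp (φ j)
  have hv : Orthonormal ℝ v := by
    rw [orthonormal_iff_ite]
    intro i j
    rw [inner_toLp_toLp, h.orthonormal i j i.2 j.2]
    simp only [Subtype.ext_iff]
  have : Fact ((2 : ℝ≥0∞) ≠ ∞) := ⟨ENNReal.ofNat_ne_top⟩
  obtain ⟨d, hd, hsum⟩ := exists_seq_hasSum_of_orthonormal hv
  have hdz : ∀ n, ∀ᵐ ω ∂P, ∫ s, (X s ω - meanFun P X s) * d n s ∂(timeMeasure t0 T) = 0 := by
    intro n
    have hdn : MemLp (d n) 2 (timeMeasure t0 T) := Lp.memLp _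
    refine ae_integral_mul_eq_zero_of_covOp hX hdn (h.complete _ hdn fun j hj => ?_)
    have h1 := hd n ⟨j, hj⟩
    rw [← Lp.toLp_coeFn (d n) hdn, inner_toLp_toLp] at h1
    simpa only [mul_comm] using h1
  have hcoeff : ∀ᵐ ω ∂P, ∀ j : ℕ, (j : ℕ∞) < J →
      √(ν j) * ξ j ω = ∫ s, (X s ω - meanFun P X s) * φ j s ∂(timeMeasure t0 T) := by
    rw [ae_all_iff]
    intro j
    by_cases hj : (j : ℕ∞) < J
    · exact (h.coeff j hj).mono fun ω hω _ => hω
    · exact Eventually.of_forall fun ω hω => absurd hω hj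
  filter_upwards [ae_memLp_two_path (Y := fun s ω => X s ω - meanFun P X s)
      (memLp_sub_meanFun hX), ae_all_iff.2 hdz, hcoeff]
    with ω hY hdω hcω
  set y := hY.toLp (fun s => X s ω - meanFun P X s) with hy
  have hinner : ∀ j : {j : ℕ // (j : ℕ∞) < J}, inner ℝ (v j) y = √(ν j) * ξ j ω := by
    intro j
    rw [hy, inner_toLp_toLp, hcω j j.2]
    simp only [mul_comm]
  have hS := hsum y fun n => by
    rw [← Lp.toLp_coeFn (d n) (Lp.memLp _), hy, inner_toLp_toLp, ← hdω n]
    simp only [mul_comm]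
  have hnorm : ∀ N, eLpNorm (fun s => klTrunc P X J ν φ ξ N s ω - X s ω) 2 (timeMeasure t0 T)
      = ‖∑ j : Fin (numTerms J N), inner ℝ (v ⟨j, (lt_numTerms_iff.1 j.2).2⟩) y
          • v ⟨j, (lt_numTerms_iff.1 j.2).2⟩ - y‖ₑ := by
    intro N
    rw [Lp.enorm_def]
    refine eLpNorm_congr_ae ?_
    have h1 : ∀ j : Fin (numTerms J N), ∀ᵐ s ∂(timeMeasure t0 T),
        (inner ℝ (v ⟨j, (lt_numTerms_iff.1 j.2).2⟩) y • v ⟨j, (lt_numTerms_iff.1 j.2).2⟩) s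
          = √(ν j) * φ j s * ξ j ω := by
      intro j
      have hj := (lt_numTerms_iff.1 j.2).2
      filter_upwards [Lp.coeFn_smul (inner ℝ (v ⟨j, hj⟩) y) (v ⟨j, hj⟩),
        (h.memLp_eigenfunction j hj).coeFn_toLp] with s h2 h3
      rw [h2, Pi.smul_apply, h3, hinner, smul_eq_mul]
      ring
    filter_upwards [ae_all_iff.2 h1, Lp.coeFn_sub (∑ j : Fin (numTerms J N),
        inner ℝ (v ⟨j, (lt_numTerms_iff.1 j.2).2⟩) y • v ⟨j, (lt_numTerms_iff.1 j.2).2⟩) y,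
      Lp.coeFn_finsetSum Finset.univ (fun j : Fin (numTerms J N) =>
        inner ℝ (v ⟨j, (lt_numTerms_iff.1 j.2).2⟩) y • v ⟨j, (lt_numTerms_iff.1 j.2).2⟩),
      hY.coeFn_toLp] with s h2 h3 h4 h5
    rw [h3, Pi.sub_apply, h4, h5, Finset.sum_apply, Finset.sum_congr rfl fun j _ => h2 j, klTrunc,
      klSum]
    simp only [headVec]
    ring
  constructor
  · have ht := tendsto_sum_numTerms hS
    simp_rw [hnorm]
    have h0 := (ht.sub_const y).enorm
    rwa [sub_self, enorm_zero] at h0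
  · intro N
    rw [hnorm, ← Lp.enorm_toLp hY]
    have hinj : Function.Injective fun j : Fin (numTerms J N) =>
        (⟨j, (lt_numTerms_iff.1 j.2).2⟩ : {j : ℕ // (j : ℕ∞) < J}) :=
      fun i j hij => Fin.ext (congrArg Subtype.val hij)
    rw [enorm_le_iff_norm_le]
    exact norm_sum_inner_smul_sub_le (hv.comp _ hinj) y

/-- A Karhunen–Loève expansion converges in `L²([t0, T] × Ω)`. -/
lemma IsKarhunenLoeve.tendsto_eLpNorm [IsProbabilityMeasure P]
    (h : IsKarhunenLoeve P t0 T X J ν φ ξ)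
    (hX : MemLp (fun z : ℝ × Ω => X z.1 z.2) 2 ((timeMeasure t0 T).prod P)) :
    Tendsto (fun N => eLpNorm (fun z : ℝ × Ω => klTrunc P X J ν φ ξ N z.1 z.2 - X z.1 z.2) 2
      ((timeMeasure t0 T).prod P)) atTop (𝓝 0) := by
  have hm : ∀ N, AEMeasurable (fun z : ℝ × Ω => ‖klTrunc P X J ν φ ξ N z.1 z.2 - X z.1 z.2‖ₑ ^ 2)
      ((timeMeasure t0 T).prod P) := fun N =>
    ((h.isPathIntegrable_klTrunc hX N).aesm.sub hX.1).enorm.pow_const 2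
  have hY := memLp_sub_meanFun hX
  have hsq : Tendsto (fun N => eLpNorm (fun z : ℝ × Ω =>
      klTrunc P X J ν φ ξ N z.1 z.2 - X z.1 z.2) 2 ((timeMeasure t0 T).prod P) ^ 2)
      atTop (𝓝 0) := by
    simp_rw [sq_eLpNorm_two]
    have h1 : ∀ N, ∫⁻ z : ℝ × Ω, ‖klTrunc P X J ν φ ξ N z.1 z.2 - X z.1 z.2‖ₑ ^ 2
          ∂((timeMeasure t0 T).prod P)
        = ∫⁻ ω, eLpNorm (fun s => klTrunc P X J ν φ ξ N s ω - X s ω) 2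
            (timeMeasure t0 T) ^ 2 ∂P := by
      intro N
      simp_rw [sq_eLpNorm_two]
      exact lintegral_prod_symm _ (hm N)
    simp_rw [h1]
    have h2 := tendsto_lintegral_of_dominated_convergence' (μ := P)
      (F := fun N ω => eLpNorm (fun s => klTrunc P X J ν φ ξ N s ω - X s ω) 2
        (timeMeasure t0 T) ^ 2) (f := fun _ => 0)
      (fun ω => eLpNorm (fun s => X s ω - meanFun P X s) 2 (timeMeasure t0 T) ^ 2) ?_ ?_ ?_ ?_
    · simpa using h2
    · intro N
      simp_rw [sq_eLpNorm_two]
      exact (hm N).lintegral_prod_left'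
    · intro N
      filter_upwards [h.ae_eLpNorm_path hX] with ω hω
      exact pow_le_pow_left' (hω.2 N) 2
    · simp_rw [sq_eLpNorm_two]
      rw [← lintegral_prod_symm _ (hY.1.enorm.pow_const 2)]
      exact ((eLpNorm_two_lt_top_iff _).1 hY.2).ne
    · filter_upwards [h.ae_eLpNorm_path hX] with ω hω
      simpa [Function.comp_def] using (ENNReal.continuous_pow 2).continuousAt.tendsto.comp hω.1
  have h3 := (ENNReal.continuous_rpow_const (y := (1 / 2 : ℝ))).continuousAt.tendsto.comp hsq
  rw [ENNReal.zero_rpow_of_pos (by norm_num)] at h3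
  refine h3.congr fun N => ?_
  rw [Function.comp_apply, ← ENNReal.rpow_natCast, ← ENNReal.rpow_mul]
  norm_num

lemma IsKarhunenLoeve.tendsto_scaledDist [IsProbabilityMeasure P]
    (h : IsKarhunenLoeve P t0 T X J ν φ ξ)
    (hX : MemLp (fun z : ℝ × Ω => X z.1 z.2) 2 ((timeMeasure t0 T).prod P)) :
    Tendsto (fun N => scaledDist P t0 T X (klTrunc P X J ν φ ξ N)) atTop (𝓝 0) := by
  have := ENNReal.Tendsto.const_mul (a := (timeMeasure t0 T univ) ^ (1 / 2 : ℝ))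
    (h.tendsto_eLpNorm hX) (Or.inr (by finiteness))
  simpa only [mul_zero, scaledDist] using this

end

section

variable {Ω : Type*} [MeasurableSpace Ω] {P : Measure Ω} {t0 T : ℝ}

/-! ### Passage to the limit -/

/-- A sequence of coefficient pairs `(aN, bN)` which converges to `(a, b)` in `L²([t0, T] × Ω)`
and satisfies the moment bounds that control the Hölder estimates. -/
structure IsApproximation (P : Measure Ω) (t0 T : ℝ) (p q : ℝ≥0∞) (C : ℝ≥0) (D : ℝ≥0∞)
    (a b : ℝ → Ω → ℝ) (aN bN : ℕ → ℝ → Ω → ℝ) : Prop where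
  le : t0 ≤ T
  exponents : 1 / p + 2 / q = 1 / 2
  one_le : 1 ≤ q
  one_le_const : 1 ≤ C
  const_lt_top : D < ∞
  path_a : IsPathIntegrable P t0 T a
  path_b : IsPathIntegrable P t0 T b
  path_aN : ∀ N, IsPathIntegrable P t0 T (aN N)
  path_bN : ∀ N, IsPathIntegrable P t0 T (bN N)
  tendsto_a : Tendsto (fun N => scaledDist P t0 T a (aN N)) atTop (𝓝 0)
  tendsto_b : Tendsto (fun N => scaledDist P t0 T b (bN N)) atTop (𝓝 0)
  exp_bound : ∀ N, ∀ t ∈ Icc t0 T,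
    eLpNorm (fun ω => Real.exp (-primitive t0 (aN N) t ω)) q P ≤ C
  bN_bound : ∀ N, ∫⁻ s, eLpNorm (bN N s) p P ∂(timeMeasure t0 T) ≤ D

namespace IsApproximation

variable {p q : ℝ≥0∞} {C : ℝ≥0} {D : ℝ≥0∞} {a b : ℝ → Ω → ℝ} {aN bN : ℕ → ℝ → Ω → ℝ}

lemma tendstoInMeasure_primitive [IsProbabilityMeasure P]
    (h : IsApproximation P t0 T p q C D a b aN bN) {t : ℝ} (ht : t ∈ Icc t0 T) :
    TendstoInMeasure P (fun N => primitive t0 (aN N) t) atTop (primitive t0 a t) := by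
  refine tendstoInMeasure_of_tendsto_eLpNorm (p := 2) two_ne_zero
    (fun N => aestronglyMeasurable_primitive_apply (h.path_aN N).aesm ht)
    (aestronglyMeasurable_primitive_apply h.path_a.aesm ht) ?_
  exact tendsto_of_tendsto_of_tendsto_of_le_of_le tendsto_const_nhds h.tendsto_a
    (fun _ => zero_le) fun N => eLpNorm_primitive_sub_le h.path_a (h.path_aN N) ht

/-- By Fatou's lemma the moment bound on the discount factor passes to the limit. -/
lemma exp_bound_limit [IsProbabilityMeasure P] (h : IsApproximation P t0 T p q C D a b aN bN)
    {t : ℝ} (ht : t ∈ Icc t0 T) :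
    eLpNorm (fun ω => Real.exp (-primitive t0 a t ω)) q P ≤ C := by
  obtain ⟨ns, -, hns⟩ := (h.tendstoInMeasure_primitive ht).exists_seq_tendsto_ae
  have h1 := Lp.eLpNorm_lim_le_liminf_eLpNorm (p := q) (μ := P)
    (f := fun k ω => Real.exp (-primitive t0 (aN (ns k)) t ω)) (fun k =>
      Real.continuous_exp.comp_aestronglyMeasurable
        (aestronglyMeasurable_primitive_apply (h.path_aN (ns k)).aesm ht).neg)
    (fun ω => Real.exp (-primitive t0 a t ω))
    (hns.mono fun ω hω => (Real.continuous_exp.tendsto _).comp hω.neg)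
  refine h1.trans ((liminf_le_liminf (v := fun _ => (C : ℝ≥0∞))
    (Eventually.of_forall fun k => h.exp_bound _ t ht)).trans (liminf_const _).le)

lemma tendstoInMeasure_discounted [IsProbabilityMeasure P]
    (h : IsApproximation P t0 T p q C D a b aN bN) {t : ℝ} (ht : t ∈ Icc t0 T) :
    TendstoInMeasure P (fun N => discounted t0 (aN N) (bN N) t) atTop (discounted t0 a b t) := by
  refine tendstoInMeasure_of_tendsto_eLpNorm (p := 1) one_ne_zero
    (fun N => aestronglyMeasurable_discounted_apply (h.path_aN N).aesm (h.path_bN N).aesm ht)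
    (aestronglyMeasurable_discounted_apply h.path_a.aesm h.path_b.aesm ht) ?_
  have h1C : eLpNorm (fun _ : Ω => (1 : ℝ)) q P ≤ C :=
    eLpNorm_one_const.trans (by exact_mod_cast h.one_le_const)
  have hlim : Tendsto (fun N => D * (scaledDist P t0 T a (aN N) * ((C + C) * C))
      + scaledDist P t0 T b (bN N) * (C * C)) atTop (𝓝 0) := by
    have h1 := ENNReal.Tendsto.mul_const (b := ((C : ℝ≥0∞) + C) * C) h.tendsto_a
      (Or.inr (by finiteness))
    have h2 := ENNReal.Tendsto.const_mul (a := D) h1 (Or.inr h.const_lt_top.ne)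
    have h3 := ENNReal.Tendsto.mul_const (b := (C : ℝ≥0∞) * C) h.tendsto_b
      (Or.inr (by finiteness))
    simpa using h2.add h3
  refine tendsto_of_tendsto_of_tendsto_of_le_of_le' tendsto_const_nhds hlim
    (Eventually.of_forall fun _ => zero_le) ?_
  filter_upwards [h.tendsto_a.eventually_ne ENNReal.zero_ne_top] with N hN
  have := lintegral_discounted_sub_mul_le h.le h.exponents h.one_le h.path_a (h.path_aN N) h.path_b
    (h.path_bN N) hN (fun t ht => h.exp_bound_limit ht) (h.exp_bound N) (h.bN_bound N)
    aestronglyMeasurable_const h1C ht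
  simpa only [enorm_one, mul_one, eLpNorm_one_eq_lintegral_enorm, Pi.sub_apply] using this

/-- The rate at which the mixtures converge, for space variables of absolute value at most `R`. -/
noncomputable def rate (P : Measure Ω) (t0 T : ℝ) (C L M R : ℝ≥0) (D : ℝ≥0∞)
    (a b : ℝ → Ω → ℝ) (aN bN : ℕ → ℝ → Ω → ℝ) (N : ℕ) : ℝ≥0∞ :=
  L * (R * (scaledDist P t0 T a (aN N) * ((C + C) * C))
      + (D * (scaledDist P t0 T a (aN N) * ((C + C) * C))
        + scaledDist P t0 T b (bN N) * (C * C)))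
    + M * (scaledDist P t0 T a (aN N) * ((C + C) * C))

lemma tendsto_rate (h : IsApproximation P t0 T p q C D a b aN bN) (L M R : ℝ≥0) :
    Tendsto (rate P t0 T C L M R D a b aN bN) atTop (𝓝 0) := by
  have h1 := ENNReal.Tendsto.mul_const (b := ((C : ℝ≥0∞) + C) * C) h.tendsto_a
    (Or.inr (by finiteness))
  have h2 := ENNReal.Tendsto.const_mul (a := D) h1 (Or.inr h.const_lt_top.ne)
  have h3 := ENNReal.Tendsto.mul_const (b := (C : ℝ≥0∞) * C) h.tendsto_b
    (Or.inr (by finiteness))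
  have h4 := ENNReal.Tendsto.const_mul (a := (R : ℝ≥0∞)) h1 (Or.inr (by finiteness))
  have h5 := ENNReal.Tendsto.const_mul (a := (M : ℝ≥0∞)) h1 (Or.inr (by finiteness))
  have h6 := ENNReal.Tendsto.const_mul (a := (L : ℝ≥0∞)) (h4.add (h2.add h3))
    (Or.inr (by finiteness))
  have h7 := h6.add h5
  simp only [zero_mul, mul_zero, add_zero] at h7
  exact h7

section Mixture

variable {f0 : ℝ → ℝ} {L M : ℝ≥0}

/-- The mixtures converge uniformly in time and locally uniformly in space. -/
lemma eventually_enorm_sub_le [IsProbabilityMeasure P]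
    (h : IsApproximation P t0 T p q C D a b aN bN) (hL : LipschitzWith L f0)
    (hpos : ∀ x, 0 ≤ f0 x) (hM : ∀ x, f0 x ≤ M) (R : ℝ≥0) :
    ∀ᶠ N in atTop, ∀ x : ℝ, ‖x‖ₑ ≤ R → ∀ t ∈ Icc t0 T,
      ‖mixDensity P t0 (aN N) (bN N) f0 x t - mixDensity P t0 a b f0 x t‖ₑ
        ≤ rate P t0 T C L M R D a b aN bN N := by
  filter_upwards [h.tendsto_a.eventually_ne ENNReal.zero_ne_top] with N hN x hx t ht
  refine (enorm_mixDensity_sub_le h.le h.exponents h.one_le h.path_a (h.path_aN N) h.path_b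
    (h.path_bN N) h.one_le_const hN (fun t ht => h.exp_bound_limit ht) (h.exp_bound N)
    (h.bN_bound N) hL hpos hM x ht).trans ?_
  rw [rate]
  gcongr

lemma tendsto_mixDensity [IsProbabilityMeasure P]
    (h : IsApproximation P t0 T p q C D a b aN bN) (hL : LipschitzWith L f0)
    (hpos : ∀ x, 0 ≤ f0 x) (hM : ∀ x, f0 x ≤ M) (x : ℝ) {t : ℝ} (ht : t ∈ Icc t0 T) :
    Tendsto (fun N => mixDensity P t0 (aN N) (bN N) f0 x t) atTop
      (𝓝 (mixDensity P t0 a b f0 x t)) := by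
  rw [tendsto_iff_edist_tendsto_0]
  refine tendsto_of_tendsto_of_tendsto_of_le_of_le' tendsto_const_nhds
    (h.tendsto_rate L M ‖x‖₊) (Eventually.of_forall fun _ => zero_le) ?_
  filter_upwards [h.eventually_enorm_sub_le hL hpos hM ‖x‖₊] with N hN
  rw [edist_eq_enorm_sub]
  exact hN x le_rfl t ht

end Mixture

end IsApproximation

section Bound

variable {q : ℝ≥0∞} {C : ℝ≥0} {a b : ℝ → Ω → ℝ} {f0 : ℝ → ℝ}

lemma integrable_exp_neg_primitive [IsProbabilityMeasure P]
    (hq : 1 ≤ q) (ha : IsPathIntegrable P t0 T a) {t : ℝ} (ht : t ∈ Icc t0 T)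
    (hC : eLpNorm (fun ω => Real.exp (-primitive t0 a t ω)) q P ≤ C) :
    Integrable (fun ω => Real.exp (-primitive t0 a t ω)) P :=
  MemLp.integrable hq ⟨Real.continuous_exp.comp_aestronglyMeasurable
    (aestronglyMeasurable_primitive_apply ha.aesm ht).neg, hC.trans_lt ENNReal.coe_lt_top⟩

lemma mixDensity_nonneg (hpos : ∀ x, 0 ≤ f0 x) (x t : ℝ) : 0 ≤ mixDensity P t0 a b f0 x t :=
  integral_nonneg fun _ => mul_nonneg (hpos _) (Real.exp_pos _).le

lemma mixDensity_le [IsProbabilityMeasure P] (hq : 1 ≤ q) (ha : IsPathIntegrable P t0 T a)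
    (hb : IsPathIntegrable P t0 T b) (hc : Continuous f0)
    (hpos : ∀ x, 0 ≤ f0 x) {M : ℝ≥0} (hM : ∀ x, f0 x ≤ M) (x : ℝ) {t : ℝ} (ht : t ∈ Icc t0 T)
    (hC : eLpNorm (fun ω => Real.exp (-primitive t0 a t ω)) q P ≤ C) :
    mixDensity P t0 a b f0 x t ≤ M * C := by
  have hE := integrable_exp_neg_primitive hq ha ht hC
  have hB := aestronglyMeasurable_discounted_apply ha.aesm hb.aesm ht
  have h1 : ∫ ω, Real.exp (-primitive t0 a t ω) ∂P ≤ C := by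
    rw [integral_eq_lintegral_of_nonneg_ae (Eventually.of_forall fun _ => (Real.exp_pos _).le)
      hE.aestronglyMeasurable]
    refine ENNReal.toReal_le_coe_of_le_coe (le_trans (le_of_eq ?_)
      ((eLpNorm_le_eLpNorm_of_exponent_le hq hE.aestronglyMeasurable).trans hC))
    rw [eLpNorm_one_eq_lintegral_enorm]
    exact lintegral_congr fun ω => (Real.enorm_of_nonneg (Real.exp_pos _).le).symm
  calc mixDensity P t0 a b f0 x t
      ≤ ∫ ω, M * Real.exp (-primitive t0 a t ω) ∂P :=
        integral_mono (integrable_mix hc hpos hM hB hE x) (hE.const_mul _) fun ω =>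
          mul_le_mul_of_nonneg_right (hM _) (Real.exp_pos _).le
    _ ≤ M * C := by
        rw [integral_const_mul]
        exact mul_le_mul_of_nonneg_left h1 M.2

/-- The mixture is essentially bounded on `ℝ × [t0, T]`. -/
lemma memLp_top_mixDensity [IsProbabilityMeasure P] (hq : 1 ≤ q) (ha : IsPathIntegrable P t0 T a)
    (hb : IsPathIntegrable P t0 T b) (hc : Continuous f0)
    (hpos : ∀ x, 0 ≤ f0 x) {M : ℝ≥0} (hM : ∀ x, f0 x ≤ M)
    (hC : ∀ t ∈ Icc t0 T, eLpNorm (fun ω => Real.exp (-primitive t0 a t ω)) q P ≤ C) :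
    MemLp (fun z : ℝ × ℝ => mixDensity P t0 a b f0 z.1 z.2) ∞
      (volume.restrict (univ ×ˢ Icc t0 T)) := by
  refine memLp_top_of_bound (aestronglyMeasurable_mixDensity ha.aesm hb.aesm hc) (M * C : ℝ) ?_
  filter_upwards [ae_restrict_mem (MeasurableSet.univ.prod measurableSet_Icc)] with z hz
  rw [Real.norm_of_nonneg (mixDensity_nonneg hpos _ _)]
  exact mixDensity_le hq ha hb hc hpos hM _ hz.2 (hC _ hz.2)

end Bound

namespace IsApproximation

variable {p q : ℝ≥0∞} {C : ℝ≥0} {D : ℝ≥0∞} {a b : ℝ → Ω → ℝ} {aN bN : ℕ → ℝ → Ω → ℝ}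
  {f0 : ℝ → ℝ} {L M : ℝ≥0} {x0 : Ω → ℝ}

lemma tendsto_eLpNorm_top [IsProbabilityMeasure P]
    (h : IsApproximation P t0 T p q C D a b aN bN) (hL : LipschitzWith L f0)
    (hpos : ∀ x, 0 ≤ f0 x) (hM : ∀ x, f0 x ≤ M) {J : Set ℝ} (hJ : Bornology.IsBounded J) :
    Tendsto (fun N => eLpNorm (fun z : ℝ × ℝ => mixDensity P t0 (aN N) (bN N) f0 z.1 z.2
      - mixDensity P t0 a b f0 z.1 z.2) ∞ (volume.restrict (J ×ˢ Icc t0 T))) atTop (𝓝 0) := by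
  obtain ⟨r, hr⟩ := hJ.subset_closedBall 0
  refine tendsto_of_tendsto_of_tendsto_of_le_of_le' tendsto_const_nhds
    (h.tendsto_rate L M r.toNNReal) (Eventually.of_forall fun _ => zero_le) ?_
  filter_upwards [h.eventually_enorm_sub_le hL hpos hM r.toNNReal] with N hN
  -- `J` need not be measurable, so the norm is taken over a ball containing it
  refine (eLpNorm_mono_measure _ (Measure.restrict_mono (prod_mono hr subset_rfl) le_rfl)).trans ?_
  rw [eLpNorm_exponent_top]
  refine eLpNormEssSup_le_of_ae_enorm_bound ?_
  filter_upwards [ae_restrict_mem (measurableSet_closedBall.prod measurableSet_Icc)] with z hz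
  refine hN z.1 ?_ z.2 hz.2
  have := hz.1
  rw [mem_closedBall_zero_iff] at this
  rw [← ofReal_norm]
  exact ENNReal.ofReal_le_ofReal this

/-- Along a subsequence the approximating solutions converge almost surely. -/
lemma exists_seq_tendsto_solution [IsProbabilityMeasure P]
    (h : IsApproximation P t0 T p q C D a b aN bN) (x0 : Ω → ℝ) {t : ℝ} (ht : t ∈ Icc t0 T) :
    ∃ ns : ℕ → ℕ, StrictMono ns ∧ ∀ᵐ ω ∂P,
      Tendsto (fun k => solution t0 (aN (ns k)) (bN (ns k)) x0 t ω) atTop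
        (𝓝 (solution t0 a b x0 t ω)) := by
  obtain ⟨ns, hns, hK⟩ := (h.tendstoInMeasure_primitive ht).exists_seq_tendsto_ae
  obtain ⟨ms, hms, hB⟩ := ((h.tendstoInMeasure_discounted ht).comp
    hns.tendsto_atTop).exists_seq_tendsto_ae
  refine ⟨ns ∘ ms, hns.comp hms, ?_⟩
  filter_upwards [hK, hB, h.path_a.integrable, ae_all_iff.2 fun N => (h.path_aN N).integrable]
    with ω h1 h2 h3 h4
  rw [solution_eq_exp_mul_add x0 h3 ht]
  simp_rw [solution_eq_exp_mul_add x0 (h4 _) ht]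
  exact ((Real.continuous_exp.tendsto _).comp (h1.comp hms.tendsto_atTop)).mul
    (h2.const_add (x0 ω))

/-- If the mixtures are densities of the approximating solutions, then the limiting mixture is a
density of the limiting solution: both laws integrate compactly supported continuous functions to
the same value. -/
lemma hasDensity_solution [IsProbabilityMeasure P]
    (h : IsApproximation P t0 T p q C D a b aN bN) (hL : LipschitzWith L f0)
    (hpos : ∀ x, 0 ≤ f0 x) (hM : ∀ x, f0 x ≤ M) (hx0 : AEMeasurable x0 P) {t : ℝ}
    (ht : t ∈ Icc t0 T)
    (hN : ∀ N, HasDensity P (solution t0 (aN N) (bN N) x0 t)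
      (fun x => mixDensity P t0 (aN N) (bN N) f0 x t)) :
    HasDensity P (solution t0 a b x0 t) (fun x => mixDensity P t0 a b f0 x t) := by
  have hC := h.exp_bound_limit ht
  have hE := integrable_exp_neg_primitive h.one_le h.path_a ht hC
  have hK := aestronglyMeasurable_primitive_apply h.path_a.aesm ht
  have hB := aestronglyMeasurable_discounted_apply h.path_a.aesm h.path_b.aesm ht
  have hcont : Continuous fun x => mixDensity P t0 a b f0 x t :=
    continuous_mix hL.continuous hpos hM hB hE
  have hmeas : AEMeasurable (solution t0 a b x0 t) P :=
    (hK.aemeasurable.exp.mul (hx0.add hB.aemeasurable)).congr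
      (h.path_a.integrable.mono fun ω hω => (solution_eq_exp_mul_add x0 hω ht).symm)
  refine ⟨hmeas, hcont.measurable, fun x => mixDensity_nonneg hpos x t, ?_⟩
  have hprob : IsProbabilityMeasure (P.map (solution t0 a b x0 t)) :=
    Measure.isProbabilityMeasure_map hmeas
  have hlf : IsLocallyFiniteMeasure ((volume : Measure ℝ).withDensity
      fun x => ENNReal.ofReal (mixDensity P t0 a b f0 x t)) :=
    IsLocallyFiniteMeasure.withDensity_ofReal hcont
  have hdens : ∀ (G : ℝ → ℝ) (g : ℝ → ℝ), (∀ x, 0 ≤ G x) → Measurable G →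
      ∫ x, g x ∂(volume.withDensity fun x => ENNReal.ofReal (G x)) = ∫ x, G x * g x := by
    intro G g hG0 hGm
    rw [integral_withDensity_eq_integral_toReal_smul hGm.ennreal_ofReal
      (Eventually.of_forall fun _ => ENNReal.ofReal_lt_top)]
    simp only [ENNReal.toReal_ofReal (hG0 _), smul_eq_mul]
  refine Measure.ext_of_integral_eq_on_compactlySupported fun g => ?_
  have hg : Continuous g := g.continuous
  rw [hdens _ _ (fun x => mixDensity_nonneg hpos x t) hcont.measurable,
    integral_map hmeas hg.aestronglyMeasurable]
  obtain ⟨ns, hns, hlim⟩ := h.exists_seq_tendsto_solution x0 ht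
  have heq : ∀ N, ∫ ω, g (solution t0 (aN N) (bN N) x0 t ω) ∂P
      = ∫ x, mixDensity P t0 (aN N) (bN N) f0 x t * g x := by
    intro N
    rw [← hdens _ _ (hN N).nonneg (hN N).measurable, ← (hN N).map_eq,
      integral_map (hN N).aemeasurable hg.aestronglyMeasurable]
  obtain ⟨c, hc⟩ := g.hasCompactSupport.exists_bound_of_continuous hg
  have hl : Tendsto (fun k => ∫ ω, g (solution t0 (aN (ns k)) (bN (ns k)) x0 t ω) ∂P) atTop
      (𝓝 (∫ ω, g (solution t0 a b x0 t ω) ∂P)) := by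
    refine tendsto_integral_of_dominated_convergence (fun _ => c) (fun k =>
      hg.comp_aestronglyMeasurable (hN (ns k)).aemeasurable.aestronglyMeasurable)
      (integrable_const _) (fun k => Eventually.of_forall fun ω => hc _) ?_
    filter_upwards [hlim] with ω hω
    exact (hg.tendsto _).comp hω
  have hr : Tendsto (fun N => ∫ x, mixDensity P t0 (aN N) (bN N) f0 x t * g x) atTop
      (𝓝 (∫ x, mixDensity P t0 a b f0 x t * g x)) := by
    refine tendsto_integral_of_dominated_convergence (fun x => (M * C : ℝ) * ‖g x‖) (fun N =>
      ((hN N).measurable.mul hg.measurable).aestronglyMeasurable)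
      ((hg.integrable_of_hasCompactSupport g.hasCompactSupport).norm.const_mul _)
      (fun N => Eventually.of_forall fun x => ?_) (Eventually.of_forall fun x => ?_)
    · rw [norm_mul, Real.norm_of_nonneg (mixDensity_nonneg hpos _ _)]
      exact mul_le_mul_of_nonneg_right (mixDensity_le h.one_le (h.path_aN N) (h.path_bN N)
        hL.continuous hpos hM x ht (h.exp_bound N t ht)) (norm_nonneg _)
    · exact (h.tendsto_mixDensity hL hpos hM x ht).mul_const _
  simp_rw [heq] at hl
  exact tendsto_nhds_unique hl (hr.comp hns.tendsto_atTop)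

end IsApproximation

end

section

variable {Ω : Type*} [MeasurableSpace Ω] {P : Measure Ω} {t0 T : ℝ}

/-! ### The truncated problems -/

section Truncated

variable {ma mb : ℝ → ℝ} {ν γ : ℕ → ℝ} {φ ψ : ℕ → ℝ → ℝ} {n m : ℕ}
  {Z : Ω → (Fin n → ℝ) × (Fin m → ℝ)} {fj : (Fin n → ℝ) × (Fin m → ℝ) → ℝ} {f0 : ℝ → ℝ}

/-- The integral over the coefficient space is the mixture for the truncated coefficients. -/
lemma truncDensity_eq_mixDensity [IsProbabilityMeasure P]
    (hma : Integrable ma (timeMeasure t0 T)) (hmb : Integrable mb (timeMeasure t0 T))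
    (hφ : ∀ j : Fin n, Integrable (φ j) (timeMeasure t0 T))
    (hψ : ∀ j : Fin m, Integrable (ψ j) (timeMeasure t0 T))
    (hZ : HasDensity P Z fj) (hf0 : Continuous f0) (x : ℝ) {t : ℝ} (ht : t ∈ Icc t0 T) :
    truncDensity t0 ma mb ν γ φ ψ f0 fj x t
      = mixDensity P t0 (fun s ω => klSum ma ν φ (Z ω).1 s) (fun s ω => klSum mb γ ψ (Z ω).2 s)
        f0 x t := by
  have : IsProbabilityMeasure (P.map Z) := Measure.isProbabilityMeasure_map hZ.aemeasurable
  have h1 := isPathIntegrable_klSum (P := P.map Z) (ν := ν) hma hφ (Z := Prod.fst)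
    measurable_fst.aemeasurable
  have h2 := isPathIntegrable_klSum (P := P.map Z) (ν := γ) hmb hψ (Z := Prod.snd)
    measurable_snd.aemeasurable
  have h3 := integral_map hZ.aemeasurable
    (aestronglyMeasurable_mixDensity_integrand
      (a := fun s (z : (Fin n → ℝ) × (Fin m → ℝ)) => klSum ma ν φ z.1 s)
      (b := fun s (z : (Fin n → ℝ) × (Fin m → ℝ)) => klSum mb γ ψ z.2 s) h1.aesm h2.aesm hf0 x ht)
  rw [hZ.map_eq, integral_withDensity_eq_integral_toReal_smul hZ.measurable.ennreal_ofReal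
    (Eventually.of_forall fun _ => ENNReal.ofReal_lt_top)] at h3
  rw [truncDensity]
  refine Eq.trans (integral_congr_ae (Eventually.of_forall fun z => ?_)) h3
  simp only [ENNReal.toReal_ofReal (hZ.nonneg z), smul_eq_mul]
  rw [mul_comm (f0 _) (fj z), mul_assoc]
  rfl

/-- The truncated solution has the mixture as a density, since its coefficients are functions of
finitely many random variables which are independent of the initial value. -/
lemma hasDensity_solution_klSum [IsProbabilityMeasure P]
    (hma : Integrable ma (timeMeasure t0 T)) (hmb : Integrable mb (timeMeasure t0 T))
    (hφ : ∀ j : Fin n, Integrable (φ j) (timeMeasure t0 T))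
    (hψ : ∀ j : Fin m, Integrable (ψ j) (timeMeasure t0 T))
    (hZ : AEMeasurable Z P) (hf0 : Continuous f0) {M : ℝ} (hM : ∀ x, f0 x ≤ M) {x0 : Ω → ℝ}
    (hx0 : HasDensity P x0 f0) (hind : IndepFun x0 Z P) {t : ℝ} (ht : t ∈ Icc t0 T)
    (hE : Integrable (fun ω =>
      Real.exp (-primitive t0 (fun s ω => klSum ma ν φ (Z ω).1 s) t ω)) P) :
    HasDensity P (solution t0 (fun s ω => klSum ma ν φ (Z ω).1 s)
        (fun s ω => klSum mb γ ψ (Z ω).2 s) x0 t)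
      (fun x => mixDensity P t0 (fun s ω => klSum ma ν φ (Z ω).1 s)
        (fun s ω => klSum mb γ ψ (Z ω).2 s) f0 x t) := by
  have : IsProbabilityMeasure (P.map Z) := Measure.isProbabilityMeasure_map hZ
  have h1 := isPathIntegrable_klSum (P := P.map Z) (ν := ν) hma hφ (Z := Prod.fst)
    measurable_fst.aemeasurable
  have h2 := isPathIntegrable_klSum (P := P.map Z) (ν := γ) hmb hψ (Z := Prod.snd)
    measurable_snd.aemeasurable
  have hK := aestronglyMeasurable_primitive_apply
    (a := fun s (z : (Fin n → ℝ) × (Fin m → ℝ)) => klSum ma ν φ z.1 s) h1.aesm ht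
  have hB := aestronglyMeasurable_discounted_apply
    (a := fun s (z : (Fin n → ℝ) × (Fin m → ℝ)) => klSum ma ν φ z.1 s)
    (b := fun s (z : (Fin n → ℝ) × (Fin m → ℝ)) => klSum mb γ ψ z.2 s) h1.aesm h2.aesm ht
  have hind' := hind.comp₀ hx0.aemeasurable hZ aemeasurable_id
    (hK.aemeasurable.prodMk hB.aemeasurable)
  have key := hasDensity_exp_mul_add hx0 hf0 hM (hK.comp_aemeasurable hZ)
    (hB.comp_aemeasurable hZ) hE hind'
  have hsol : solution t0 (fun s ω => klSum ma ν φ (Z ω).1 s)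
        (fun s ω => klSum mb γ ψ (Z ω).2 s) x0 t
      = fun ω => Real.exp (primitive t0 (fun s ω => klSum ma ν φ (Z ω).1 s) t ω)
        * (x0 ω + discounted t0 (fun s ω => klSum ma ν φ (Z ω).1 s)
          (fun s ω => klSum mb γ ψ (Z ω).2 s) t ω) := by
    funext ω
    exact solution_eq_exp_mul_add x0
      (hma.add (integrable_finsetSum _ fun j _ => ((hφ j).const_mul _).mul_const _)) ht
  rw [hsol]
  exact key

end Truncated

/-- Uniform bound of the truncations in `L¹([t0, T]; L^p(Ω))` by the sum of the norms of the terms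
of the expansion. -/
lemma lintegral_eLpNorm_klTrunc_le {X : ℝ → Ω → ℝ} {J : ℕ∞} {γ : ℕ → ℝ} {ψ : ℕ → ℝ → ℝ}
    {η : ℕ → Ω → ℝ} [IsProbabilityMeasure P] (h : IsKarhunenLoeve P t0 T X J γ ψ η)
    (hX : MemLp (fun z : ℝ × Ω => X z.1 z.2) 2 ((timeMeasure t0 T).prod P)) {p : ℝ≥0∞}
    (hp : 1 ≤ p) (N : ℕ) :
    ∫⁻ s, eLpNorm (klTrunc P X J γ ψ η N s) p P ∂(timeMeasure t0 T)
      ≤ (eLpNorm (meanFun P X) p (timeMeasure t0 T)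
          + ∑' j : {j : ℕ // (j : ℕ∞) < J}, ENNReal.ofReal (√(γ j))
            * eLpNorm (ψ j) p (timeMeasure t0 T) * eLpNorm (η j) p P)
        * (timeMeasure t0 T univ) ^ (1 - 1 / p.toReal) := by
  have hj : ∀ j : Fin (numTerms J N), (j : ℕ∞) < J := fun j => (lt_numTerms_iff.1 j.2).2
  have hψ : ∀ j : Fin (numTerms J N), AEStronglyMeasurable (ψ j) (timeMeasure t0 T) :=
    fun j => (h.memLp_eigenfunction j (hj j)).1
  have hmean := (memLp_meanFun hX).1
  have hone : ∀ {f : ℝ → ℝ}, AEStronglyMeasurable f (timeMeasure t0 T) →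
      ∫⁻ s, ‖f s‖ₑ ∂(timeMeasure t0 T) ≤ eLpNorm f p (timeMeasure t0 T)
        * (timeMeasure t0 T univ) ^ (1 - 1 / p.toReal) := by
    intro f hf
    have := eLpNorm_le_eLpNorm_mul_rpow_measure_univ hp hf
    rwa [eLpNorm_one_eq_lintegral_enorm, ENNReal.toReal_one, div_one] at this
  have hpt : ∀ s, eLpNorm (klTrunc P X J γ ψ η N s) p P
      ≤ ‖meanFun P X s‖ₑ + ∑ j : Fin (numTerms J N),
        ENNReal.ofReal (√(γ j)) * ‖ψ j s‖ₑ * eLpNorm (η j) p P := by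
    intro s
    have hterm : ∀ j : Fin (numTerms J N),
        AEStronglyMeasurable (fun ω => √(γ j) * ψ j s * η j ω) P := fun j =>
      (h.memLp_coeff j (hj j)).1.const_mul _
    have h1 : klTrunc P X J γ ψ η N s = (fun _ => meanFun P X s)
        + ∑ j : Fin (numTerms J N), fun ω => √(γ j) * ψ j s * η j ω := by
      funext ω
      simp only [Pi.add_apply, Finset.sum_apply]
      rfl
    rw [h1]
    refine (eLpNorm_add_le aestronglyMeasurable_const
      (Finset.aestronglyMeasurable_sum _ fun j _ => hterm j) hp).trans (add_le_add ?_ ?_)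
    · rw [eLpNorm_const _ (one_pos.trans_le hp).ne' (IsProbabilityMeasure.ne_zero P)]
      simp
    · refine (eLpNorm_sum_le (fun j _ => hterm j) hp).trans (Finset.sum_le_sum fun j _ => ?_)
      have h2 : (fun ω => √(γ j) * ψ j s * η j ω) = (√(γ j) * ψ j s) • η j := rfl
      rw [h2, eLpNorm_const_smul, enorm_mul, Real.enorm_of_nonneg (Real.sqrt_nonneg _)]
  have hsum : ∑ j : Fin (numTerms J N), ENNReal.ofReal (√(γ j))
        * eLpNorm (ψ j) p (timeMeasure t0 T) * eLpNorm (η j) p P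
      ≤ ∑' j : {j : ℕ // (j : ℕ∞) < J}, ENNReal.ofReal (√(γ j))
        * eLpNorm (ψ j) p (timeMeasure t0 T) * eLpNorm (η j) p P := by
    rw [← tsum_fintype (L := SummationFilter.unconditional _)]
    exact ENNReal.tsum_comp_le_tsum_of_injective
      (f := fun j : Fin (numTerms J N) => (⟨j, hj j⟩ : {j : ℕ // (j : ℕ∞) < J}))
      (fun i j hij => Fin.ext (congrArg Subtype.val hij))
      (fun j => ENNReal.ofReal (√(γ j)) * eLpNorm (ψ j) p (timeMeasure t0 T) * eLpNorm (η j) p P)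
  refine (lintegral_mono hpt).trans ?_
  rw [lintegral_add_left' hmean.enorm, lintegral_finsetSum' _ fun j _ =>
    ((hψ j).enorm.const_mul _).mul_const _, add_mul]
  refine add_le_add (hone hmean) ?_
  refine le_trans ?_ (mul_le_mul_left hsum _)
  rw [Finset.sum_mul]
  refine Finset.sum_le_sum fun j _ => ?_
  rw [lintegral_mul_const'' _ ((hψ j).enorm.const_mul _), lintegral_const_mul'' _ (hψ j).enorm]
  calc _ ≤ ENNReal.ofReal (√(γ j)) * (eLpNorm (ψ j) p (timeMeasure t0 T)
        * (timeMeasure t0 T univ) ^ (1 - 1 / p.toReal)) * eLpNorm (η j) p P := by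
        gcongr
        exact hone (hψ j)
    _ = _ := by ring

end

end RandomLinearODE

open RandomLinearODE
theorem mainTheorem1 {Ω : Type*} [MeasurableSpace Ω] (P : Measure Ω) [IsProbabilityMeasure P]
    (t0 T : ℝ) (hT : t0 < T)
    (a b : ℝ → Ω → ℝ) (x0 : Ω → ℝ)
    -- the coefficient processes are square integrable on `[t0, T] × Ω`
    (ha : MemLp (fun z : ℝ × Ω => a z.1 z.2) 2 ((timeMeasure t0 T).prod P))
    (hb : MemLp (fun z : ℝ × Ω => b z.1 z.2) 2 ((timeMeasure t0 T).prod P))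
    -- their Karhunen-Loève expansions, with `Ja` and `Jb` terms
    (Ja Jb : ℕ∞) (ν γ : ℕ → ℝ) (φ ψ : ℕ → ℝ → ℝ) (ξ η : ℕ → Ω → ℝ)
    (hKLa : IsKarhunenLoeve P t0 T a Ja ν φ ξ)
    (hKLb : IsKarhunenLoeve P t0 T b Jb γ ψ η)
    -- absolute continuity and independence of `x0` and of the truncated coefficient vectors
    (f0 : ℝ → ℝ) (hf0 : HasDensity P x0 f0)
    (fj : ∀ N : ℕ, (Fin (numTerms Ja N) → ℝ) × (Fin (numTerms Jb N) → ℝ) → ℝ)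
    (hfj : ∀ N : ℕ, 1 ≤ N → HasDensity P
      (fun ω => (headVec ξ (numTerms Ja N) ω, headVec η (numTerms Jb N) ω)) (fj N))
    (hindep : ∀ N : ℕ, 1 ≤ N → IndepFun x0
      (fun ω => (headVec ξ (numTerms Ja N) ω, headVec η (numTerms Jb N) ω)) P)
    -- the density of `x0` is Lipschitz
    (hLip : ∃ L : ℝ≥0, LipschitzWith L f0)
    -- the moment condition
    (hmom : ∃ p q : ℝ≥0∞, 2 ≤ p ∧ 4 ≤ q ∧ 1 / p + 2 / q = 1 / 2 ∧
      eLpNorm (meanFun P b) p (timeMeasure t0 T)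
        + ∑' j : {j : ℕ // (j : ℕ∞) < Jb}, ENNReal.ofReal (√(γ j))
            * eLpNorm (ψ j) p (timeMeasure t0 T) * eLpNorm (η j) p P < ∞ ∧
      ∃ C : ℝ≥0, ∀ N : ℕ, 1 ≤ N → ∀ t ∈ Icc t0 T,
        eLpNorm (fun ω => Real.exp
          (-klIntegral t0 (meanFun P a) ν φ t (headVec ξ (numTerms Ja N) ω))) q P ≤ C) :
    -- the functions `truncDensity` are densities of the truncated solutions
    (∀ N : ℕ, 1 ≤ N → ∀ t ∈ Icc t0 T, HasDensity P
      (solution t0 (klTrunc P a Ja ν φ ξ N) (klTrunc P b Jb γ ψ η N) x0 t)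
      (fun x => truncDensity t0 (meanFun P a) (meanFun P b) ν γ φ ψ f0 (fj N) x t)) ∧
    -- and they converge to a density of the solution
    ∃ f1 : ℝ → ℝ → ℝ,
      (∀ t ∈ Icc t0 T, HasDensity P (solution t0 a b x0 t) (fun x => f1 x t)) ∧
      (∀ x : ℝ, ∀ t ∈ Icc t0 T, Tendsto
        (fun N => truncDensity t0 (meanFun P a) (meanFun P b) ν γ φ ψ f0 (fj N) x t)
        atTop (𝓝 (f1 x t))) ∧
      ∀ J : Set ℝ, Bornology.IsBounded J →
        (∀ N : ℕ, 1 ≤ N → MemLp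
          (fun z : ℝ × ℝ =>
            truncDensity t0 (meanFun P a) (meanFun P b) ν γ φ ψ f0 (fj N) z.1 z.2) ∞
          (volume.restrict (J ×ˢ Icc t0 T))) ∧
        MemLp (fun z : ℝ × ℝ => f1 z.1 z.2) ∞ (volume.restrict (J ×ˢ Icc t0 T)) ∧
        Tendsto
          (fun N => eLpNorm
            (fun z : ℝ × ℝ =>
              truncDensity t0 (meanFun P a) (meanFun P b) ν γ φ ψ f0 (fj N) z.1 z.2
                - f1 z.1 z.2) ∞
            (volume.restrict (J ×ˢ Icc t0 T)))
          atTop (𝓝 0) := by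
  obtain ⟨L, hL⟩ := hLip
  obtain ⟨M', hM'⟩ := bddAbove_of_lipschitz_of_integrable hL hf0.nonneg hf0.integrable
  have hM : ∀ x, f0 x ≤ M'.toNNReal := fun x => (hM' x).trans (Real.le_coe_toNNReal _)
  obtain ⟨p, q, hp, hq, hpq, hsum, C, hC⟩ := hmom
  have hp1 : 1 ≤ p := one_le_two.trans hp
  have hq1 : 1 ≤ q := le_trans (by norm_num) hq
  have hma := (memLp_meanFun ha).integrable one_le_two
  have hmb := (memLp_meanFun hb).integrable one_le_two
  have haN := hKLa.isPathIntegrable_klTrunc ha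
  have hbN := hKLb.isPathIntegrable_klTrunc hb
  have hCN : ∀ N, 1 ≤ N → ∀ t ∈ Icc t0 T, eLpNorm (fun ω =>
      Real.exp (-primitive t0 (klTrunc P a Ja ν φ ξ N) t ω)) q P ≤ (max C 1 : ℝ≥0) :=
    fun N hN t ht => (hC N hN t ht).trans (by exact_mod_cast le_max_left _ _)
  have heq : ∀ N, 1 ≤ N → ∀ x, ∀ t ∈ Icc t0 T,
      truncDensity t0 (meanFun P a) (meanFun P b) ν γ φ ψ f0 (fj N) x t
        = mixDensity P t0 (klTrunc P a Ja ν φ ξ N) (klTrunc P b Jb γ ψ η N) f0 x t :=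
    fun N hN x t ht => truncDensity_eq_mixDensity hma hmb
      (fun j => hKLa.integrable_eigenfunction j) (fun j => hKLb.integrable_eigenfunction j)
      (hfj N hN) hL.continuous x ht
  have hdens : ∀ N, 1 ≤ N → ∀ t ∈ Icc t0 T, HasDensity P
      (solution t0 (klTrunc P a Ja ν φ ξ N) (klTrunc P b Jb γ ψ η N) x0 t)
      (fun x => mixDensity P t0 (klTrunc P a Ja ν φ ξ N) (klTrunc P b Jb γ ψ η N) f0 x t) :=
    fun N hN t ht => hasDensity_solution_klSum hma hmb
      (fun j => hKLa.integrable_eigenfunction j) (fun j => hKLb.integrable_eigenfunction j)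
      (hfj N hN).aemeasurable hL.continuous hM hf0 (hindep N hN) ht
      (integrable_exp_neg_primitive hq1 (haN N) ht (hCN N hN t ht))
  -- the hypotheses start at `N = 1`, so the approximating sequence is shifted by one
  have happ : IsApproximation P t0 T p q (max C 1)
      ((eLpNorm (meanFun P b) p (timeMeasure t0 T)
        + ∑' j : {j : ℕ // (j : ℕ∞) < Jb}, ENNReal.ofReal (√(γ j))
            * eLpNorm (ψ j) p (timeMeasure t0 T) * eLpNorm (η j) p P)
        * (timeMeasure t0 T univ) ^ (1 - 1 / p.toReal))
      a b (fun N => klTrunc P a Ja ν φ ξ (N + 1)) (fun N => klTrunc P b Jb γ ψ η (N + 1)) :=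
    { le := hT.le
      exponents := hpq
      one_le := hq1
      one_le_const := le_max_right _ _
      const_lt_top := by
        refine ENNReal.mul_lt_top hsum (ENNReal.rpow_lt_top_of_nonneg ?_ (measure_ne_top _ _))
        rw [sub_nonneg, one_div]
        rcases eq_or_ne p ∞ with rfl | hpt
        · simp
        · refine inv_le_one_of_one_le₀ ?_
          rwa [← ENNReal.toReal_one, ENNReal.toReal_le_toReal ENNReal.one_ne_top hpt]
      path_a := isPathIntegrable_of_memLp_two ha
      path_b := isPathIntegrable_of_memLp_two hb
      path_aN := fun N => haN _
      path_bN := fun N => hbN _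
      tendsto_a := (tendsto_add_atTop_iff_nat 1).2 (hKLa.tendsto_scaledDist ha)
      tendsto_b := (tendsto_add_atTop_iff_nat 1).2 (hKLb.tendsto_scaledDist hb)
      exp_bound := fun N => hCN _ N.succ_pos
      bN_bound := fun N => lintegral_eLpNorm_klTrunc_le hKLb hb hp1 _ }
  have hae : ∀ J : Set ℝ, ∀ᵐ z : ℝ × ℝ ∂(volume.restrict (J ×ˢ Icc t0 T)), z.2 ∈ Icc t0 T := by
    intro J
    have h1 := ae_restrict_mem (μ := (volume : Measure (ℝ × ℝ)))
      ((MeasurableSet.univ (α := ℝ)).prod (measurableSet_Icc (a := t0) (b := T)))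
    filter_upwards [ae_mono
      (Measure.restrict_mono (prod_mono (subset_univ J) subset_rfl) le_rfl) h1] with z hz
    exact hz.2
  refine ⟨fun N hN t ht => ?_, mixDensity P t0 a b f0, fun t ht => ?_, fun x t ht => ?_,
    fun J hJ => ⟨fun N hN => ?_, ?_, ?_⟩⟩
  · simp_rw [heq N hN _ t ht]
    exact hdens N hN t ht
  · exact happ.hasDensity_solution hL hf0.nonneg hM hf0.aemeasurable ht
      fun N => hdens (N + 1) N.succ_pos t ht
  · refine (tendsto_add_atTop_iff_nat 1).1 ((happ.tendsto_mixDensity hL hf0.nonneg hM x ht).congr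
      fun N => (heq (N + 1) N.succ_pos x t ht).symm)
  · refine MemLp.ae_eq ?_ ((memLp_top_mixDensity hq1 (haN N) (hbN N) hL.continuous hf0.nonneg hM
      (hCN N hN)).mono_measure
      (Measure.restrict_mono (prod_mono (subset_univ J) subset_rfl) le_rfl))
    filter_upwards [hae J] with z hz
    exact (heq N hN z.1 z.2 hz).symm
  · exact (memLp_top_mixDensity hq1 happ.path_a happ.path_b hL.continuous hf0.nonneg hM
      (fun t ht => happ.exp_bound_limit ht)).mono_measure
      (Measure.restrict_mono (prod_mono (subset_univ J) subset_rfl) le_rfl)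
  · refine (tendsto_add_atTop_iff_nat 1).1 ((happ.tendsto_eLpNorm_top hL hf0.nonneg hM hJ).congr
      fun N => eLpNorm_congr_ae ?_)
    filter_upwards [hae J] with z hz
    rw [heq (N + 1) N.succ_pos z.1 z.2 hz]
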